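/- The following decision problem is $\mathbf{NP}$-hard. Given a Boolean formula $\Phi$ in conjunctive normal form that satisfies the three conditions - each clause of $\Phi$ contains exactly three literals, which are pairwise distinct; - no clause of $\Phi$ contains both $x$ and $\neg x$ for some variable $x$; - each pair $\{\ell_1,\ell_2\}$ of distinct literals occurs in at most one clause of $\Phi$ (a repeated clause being counted with its multiplicity); decide whether $\Phi$ is satisfiable. That is, for every language $L\subseteq\{0,1\}^*$ in $\mathbf{NP}$ there is a function $f$, computable in polynomial time by a deterministic Turing machine, that maps every $w\in\{0,1\}^*$ to a (string encoding a) formula $f(w)$ in conjunctive normal form satisfying the three conditions, such that $w\in L$ if and only if $f(w)$ is satisfiable. -/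

import Mathlib

namespace SatVariant

/-! ### Polynomial time, the class NP, NP-hardness -/

/-- `f` is computed, with respect to the encodings `ea` and `eb`, by a deterministic multi-stack
Turing machine in a number of steps that is at most a polynomial in the length of the encoded
input. Every stack of the machine has a finite alphabet. -/
def PolyTimeComputable {α β A B : Type} (ea : Computability.Encoding α A)
    (eb : Computability.Encoding β B) (f : α → β) : Prop :=
  ∃ M : Turing.TM2ComputableInPolyTime ea.encode eb.encode f, ∀ k, Finite (M.tm.Γ k)

/-- The encoding of bit strings by themselves. -/
def bitStrings : Computability.Encoding (List Bool) Bool := Computability.encodingList Bool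

/-- The class NP of languages of bit strings: `L` is in NP if there are a polynomial `p` and a
polynomial-time verifier `V` such that `x` is in `L` exactly when `V` accepts `(x, y)` for some
certificate `y` of length at most `p(|x|)`. -/
def NP : Set (Set (List Bool)) :=
  {L | ∃ (p : Polynomial ℕ) (V : List Bool × List Bool → Bool),
    PolyTimeComputable (Computability.encodingProd bitStrings bitStrings)
      Computability.encodingBoolBool V ∧
    ∀ x, x ∈ L ↔ ∃ y : List Bool, y.length ≤ p.eval x.length ∧ V (x, y) = true}

/-- NP-hardness, under polynomial-time many-one reductions, of the decision problem "given an
object in `inst`, encoded by `e`, does it belong to `yes`?". The reductions may output only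
objects in `inst`. -/
def NPHard {α A : Type} (e : Computability.Encoding α A) (inst yes : Set α) : Prop :=
  ∀ L ∈ NP, ∃ f : List Bool → α, PolyTimeComputable bitStrings e f ∧
    ∀ x, f x ∈ inst ∧ (x ∈ L ↔ f x ∈ yes)

/-! ### Formulas in conjunctive normal form -/

/-- A literal: the variable with number `var` if `sign = true`, its negation otherwise. -/
structure Literal where
  var : ℕ
  sign : Bool
  deriving DecidableEq

/-- A clause: the disjunction of a list of literals. -/
abbrev Clause := List Literal

/-- A formula in conjunctive normal form: the conjunction of a list of clauses. -/
abbrev Formula := List Clause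

/-- The literal is true under the assignment `v`. -/
def Literal.IsTrue (v : ℕ → Bool) (l : Literal) : Prop := v l.var = l.sign

/-- Some assignment makes a literal true in every clause. -/
def Formula.Satisfiable (Φ : Formula) : Prop :=
  ∃ v : ℕ → Bool, ∀ c ∈ Φ, ∃ l ∈ c, l.IsTrue v

/-- Each clause contains exactly three literals (and these are pairwise distinct). -/
def Formula.ThreeLiterals (Φ : Formula) : Prop :=
  ∀ c ∈ Φ, c.length = 3 ∧ c.Nodup

/-- No clause contains both a variable and its negation. -/
def Formula.NoOppositeLiterals (Φ : Formula) : Prop :=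
  ∀ c ∈ Φ, ∀ x : ℕ, ¬ (Literal.mk x true ∈ c ∧ Literal.mk x false ∈ c)

/-- Each pair of literals occurs in at most one clause; a repeated clause counts repeatedly. -/
def Formula.PairsAtMostOnce (Φ : Formula) : Prop :=
  ∀ l₁ l₂ : Literal, l₁ ≠ l₂ → Φ.countP (fun c => l₁ ∈ c ∧ l₂ ∈ c) ≤ 1

/-! ### The encoding of formulas as strings -/

/-- The alphabet for formulas. -/
inductive FormulaSymbol
  | clause
  | literal (sign : Bool)
  | bit (b : Bool)
  deriving DecidableEq, Fintype

/-- A literal is written as its sign followed by the number of its variable in binary. -/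
def Literal.encode (l : Literal) : List FormulaSymbol :=
  .literal l.sign :: (Computability.encodeNat l.var).map .bit

/-- A clause is written as the symbol `clause` followed by its literals. -/
def Clause.encode (c : Clause) : List FormulaSymbol :=
  .clause :: c.flatMap Literal.encode

/-- A formula is written as the sequence of its clauses. -/
def Formula.encode (Φ : Formula) : List FormulaSymbol :=
  Φ.flatMap Clause.encode

/-- One step of the decoder, which reads a string from right to left and keeps the bits of the
current literal, the literals of the current clause, and the clauses read so far. -/
def decodeStep : FormulaSymbol → List Bool × Clause × Formula → List Bool × Clause × Formula
  | .bit b, (bs, c, Φ) => (b :: bs, c, Φ)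
  | .literal s, (bs, c, Φ) => ([], ⟨Computability.decodeNat bs, s⟩ :: c, Φ)
  | .clause, (_, c, Φ) => ([], [], c :: Φ)

theorem foldr_decodeStep_bits (l : List Bool) (c : Clause) (Φ : Formula) :
    (l.map FormulaSymbol.bit).foldr decodeStep ([], c, Φ) = (l, c, Φ) := by
  induction l with
  | nil => rfl
  | cons b l ih => simp only [List.map_cons, List.foldr_cons, ih, decodeStep]

theorem foldr_decodeStep_literals (d : Clause) (Φ : Formula) :
    (d.flatMap Literal.encode).foldr decodeStep ([], [], Φ) = ([], d, Φ) := by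
  induction d with
  | nil => rfl
  | cons l d ih =>
    simp [List.flatMap_cons, List.foldr_append, ih, Literal.encode, foldr_decodeStep_bits,
      decodeStep]

theorem foldr_decodeStep_clauses (Φ : Formula) :
    (Formula.encode Φ).foldr decodeStep ([], [], []) = ([], [], Φ) := by
  induction Φ with
  | nil => rfl
  | cons c Φ ih =>
    unfold Formula.encode at ih ⊢
    simp [List.flatMap_cons, List.foldr_append, ih, Clause.encode, foldr_decodeStep_literals,
      decodeStep]

/-- The encoding of formulas as strings over a finite alphabet. -/
def formulaEncoding : Computability.Encoding Formula FormulaSymbol where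
  encode := Formula.encode
  decode s := some (s.foldr decodeStep ([], [], [])).2.2
  decode_encode Φ := by rw [foldr_decodeStep_clauses]

end SatVariant

/-! The argument is that of Cook and Levin. Acceptance of some certificate is expressed by local
constraints on a space-time diagram of the verifier, these become clauses, and every clause is
rewritten so that the three conditions hold.

Rewriting. For a nonempty clause with literals l_0, …, l_{m-1}, take private variables a_0, …, a_m
and the clauses {¬a_j, l_j, a_{j+1}}. If a_0 is true and a_m is false, these imply the original
clause. Conversely, if some l_j holds, let a_j say that no literal before l_j holds. The two
constants are forced by a gadget of seven clauses in four private variables, no two of which share a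
pair of literals and none of which contains both ¬a_0 and a_m. Every new clause has at most one
literal that is not private, so different replacements never share a pair, however much the original
clauses overlap (`pairsAtMostOnce_formulaOf`, `satisfiable_formulaOf`).

Diagram. The machines have several stacks. The place (t, i) records the symbols at depth i of all
stacks after t small steps, those at the two neighbouring depths, and the control, which is repeated
along the row. A push or pop determines the new symbols at depth i from the old ones at depths i-1,
i, i+1 (`Micro.col_stackUpd`), so consecutive rows obey local rules. Row 0 prescribes the input and
leaves the certificate free. The small-step dynamics is arranged so that an accepting run continues
forever and a rejecting one gets stuck right after halting. Hence a large enough tiled square exists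
exactly if some certificate is accepted (`Micro.exists_run`, `Micro.exists_tiling_of_run`).

Computability. The clauses are finitely many fixed templates shifted to the places of the diagram,
and the names of variables are unary in the coordinates. So the formula is printed by nested loops
over counters. A small loop language, compiled to stack machines in `Prog.polyTimeComputable`, makes
this precise with step counts. -/

namespace SatVariant

/-! ### Names of variables, and rewriting clauses into the required form. -/

/-! ### Variables named by triples of numbers -/

/-- The bits of the number of the variable named by the triple `(c, t, i)`. -/
def varBits (c t i : ℕ) : List Bool :=
  List.replicate c true ++ false :: (List.replicate t true ++ false :: List.replicate (i + 1) true)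

/-- The number of the variable named by the triple `(c, t, i)`. -/
def varNum (c t i : ℕ) : ℕ := Computability.decodeNat (varBits c t i)

/-- The least significant bit comes first, so a final `true` means that there is no leading zero and
the string is the canonical binary form of its value. -/
theorem encodePosNum_decodePosNum : ∀ l : List Bool, l.getLast? = some true →
    Computability.encodePosNum (Computability.decodePosNum l) = l
  | [], h => by simp at h
  | [false], h => by simp at h
  | [true], _ => by simp [Computability.decodePosNum, Computability.encodePosNum]
  | false :: b :: l, h => by
    have := encodePosNum_decodePosNum (b :: l) (by simpa using h)
    rw [Computability.decodePosNum, Computability.encodePosNum, this]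
  | true :: b :: l, h => by
    have := encodePosNum_decodePosNum (b :: l) (by simpa using h)
    rw [Computability.decodePosNum, if_neg (by simp), Computability.encodePosNum, this]

theorem encodeNat_decodeNat (l : List Bool) (h : l.getLast? = some true) :
    Computability.encodeNat (Computability.decodeNat l) = l := by
  have hl : l ≠ [] := by rintro rfl; simp at h
  unfold Computability.encodeNat Computability.decodeNat
  rw [Num.of_to_nat, Computability.decodeNum, if_neg hl]
  rw [PosNum.cast_to_num, Computability.encodeNum]
  exact encodePosNum_decodePosNum l h

/-- The block `i + 1` keeps the last bit `true` even for `i = 0`. Consequently a program writes the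
name of a variable by copying unary counters, without binary arithmetic. -/
theorem encodeNat_varNum (c t i : ℕ) : Computability.encodeNat (varNum c t i) = varBits c t i := by
  apply encodeNat_decodeNat
  unfold varBits
  rw [List.replicate_succ']
  simp [List.getLast?_append, List.getLast?_cons]

theorem replicate_true_append_inj {a b : ℕ} {l l' : List Bool}
    (h : List.replicate a true ++ false :: l = List.replicate b true ++ false :: l') :
    a = b ∧ l = l' := by
  induction a generalizing b with
  | zero => cases b with
    | zero => simpa using h
    | succ b => simp [List.replicate_succ] at h
  | succ a ih => cases b with
    | zero => simp [List.replicate_succ] at h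
    | succ b => simpa using ih (b := b) (by simpa [List.replicate_succ] using h)

theorem varNum_inj {c t i c' t' i' : ℕ} :
    varNum c t i = varNum c' t' i' ↔ c = c' ∧ t = t' ∧ i = i' := by
  constructor
  · intro h
    have h' := congrArg Computability.encodeNat h
    rw [encodeNat_varNum, encodeNat_varNum] at h'
    obtain ⟨h₁, h'⟩ := replicate_true_append_inj h'
    obtain ⟨h₂, h'⟩ := replicate_true_append_inj h'
    have := congrArg List.length h'
    simp at this
    exact ⟨h₁, h₂, this⟩
  · rintro ⟨rfl, rfl, rfl⟩; rfl

/-! ### Templates -/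

/-- A literal relative to a position `(t, i)`. -/
structure TemplateLiteral where
  sign : Bool
  code : ℕ
  dt : ℕ
  di : ℕ

/-- The literal at the position `(t, i)`. -/
def TemplateLiteral.inst (t i : ℕ) (l : TemplateLiteral) : Literal :=
  ⟨varNum l.code (t + l.dt) (i + l.di), l.sign⟩

/-- The `j`-th auxiliary variable for the clause with number `tag`, or its negation. -/
def fresh (tag j : ℕ) (s : Bool) : TemplateLiteral := ⟨s, 2 * Nat.pair tag j + 1, 0, 0⟩

/-- A formula that forces the variable `0` to be true and the variable `1` to be false. -/
def gadgetClauses : List (List (ℕ × Bool)) :=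
  [[(0, true), (2, true), (3, true)], [(0, true), (2, false), (1, true)],
   [(0, false), (2, true), (1, false)], [(2, false), (1, false), (3, true)],
   [(2, true), (1, true), (3, false)], [(0, false), (2, false), (3, false)],
   [(0, true), (1, false), (3, false)]]

/-- The gadget on the auxiliary variables of the clause with number `tag`. -/
def gadget (tag : ℕ) : List (List TemplateLiteral) :=
  gadgetClauses.map fun c => c.map fun p => fresh tag p.1 p.2

/-- The number of the auxiliary variable that links the `j`-th literal of a clause of length `m` to
the preceding one. -/
def chainIndex (m j : ℕ) : ℕ := if j = 0 then 0 else if j = m then 1 else 4 + j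

/-- Clauses with three literals that imply the clause `C`, given the gadget. -/
def chain (tag : ℕ) (C : List TemplateLiteral) : List (List TemplateLiteral) :=
  C.zipIdx.map fun p =>
    [fresh tag (chainIndex C.length p.2) false, p.1, fresh tag (chainIndex C.length (p.2 + 1)) true]

/-- The replacement of the clause `C`, which has number `tag`. -/
def convert (tag : ℕ) (C : List TemplateLiteral) : List (List TemplateLiteral) :=
  gadget tag ++ chain tag C

/-- The replacement of the clauses of the family `f`. -/
def expand (templ : ℕ → List (List TemplateLiteral)) (f : ℕ) : List (List TemplateLiteral) :=
  (templ f).zipIdx.flatMap fun p => convert (Nat.pair f p.2) p.1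

/-- The clauses of a family at the position `(t, i)`. -/
def block (templ : ℕ → List (List TemplateLiteral)) (p : ℕ × ℕ × ℕ) : Formula :=
  (expand templ p.1).map fun c => c.map (TemplateLiteral.inst p.2.1 p.2.2)

/-- The formula with the clauses of the families at the positions in `I`. -/
def formulaOf (templ : ℕ → List (List TemplateLiteral)) (I : List (ℕ × ℕ × ℕ)) : Formula :=
  I.flatMap (block templ)

/-! ### The three conditions -/

theorem inst_inj {t i : ℕ} {l l' : TemplateLiteral} : l.inst t i = l'.inst t i ↔ l = l' := by
  cases l; cases l'
  simp [TemplateLiteral.inst, varNum_inj]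
  tauto

theorem fresh_inj {tag j tag' j' : ℕ} {s s' : Bool} :
    fresh tag j s = fresh tag' j' s' ↔ tag = tag' ∧ j = j' ∧ s = s' := by
  simp [fresh, Nat.pair_eq_pair]
  tauto

theorem chainIndex_inj {m j j' : ℕ} :
    chainIndex m j = chainIndex m j' ↔ j = j' := by
  unfold chainIndex
  grind

/-- Two clauses that have two distinct literals in common. -/
def SharePair {α : Type*} (c c' : List α) : Prop :=
  ∃ l₁ l₂, l₁ ≠ l₂ ∧ l₁ ∈ c ∧ l₂ ∈ c ∧ l₁ ∈ c' ∧ l₂ ∈ c'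

/-- `List.Pairwise` compares positions in the list, so repeated clauses are covered as well. -/
theorem countP_le_one_of_pairwise {Φ : Formula} (h : Φ.Pairwise fun c c' => ¬ SharePair c c') :
    Formula.PairsAtMostOnce Φ := by
  intro l₁ l₂ hl
  induction Φ with
  | nil => simp
  | cons c Φ ih =>
    rw [List.pairwise_cons] at h
    rw [List.countP_cons]
    split_ifs with hc
    · have : Φ.countP (fun c => l₁ ∈ c ∧ l₂ ∈ c) = 0 := by
        rw [List.countP_eq_zero]
        intro c' hc' h'
        simp only [decide_eq_true_eq] at hc h'
        exact h.1 c' hc' ⟨l₁, l₂, hl, hc.1, hc.2, h'.1, h'.2⟩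
      omega
    · simpa using ih h.2

theorem sharePair_map {α β : Type*} {f : α → β} (hf : Function.Injective f) {c c' : List α} :
    SharePair (c.map f) (c'.map f) ↔ SharePair c c' := by
  constructor
  · rintro ⟨l₁, l₂, hne, h₁, h₂, h₃, h₄⟩
    obtain ⟨a, ha, rfl⟩ := List.mem_map.1 h₁
    obtain ⟨b, hb, rfl⟩ := List.mem_map.1 h₂
    rw [List.mem_map_of_injective hf] at h₃ h₄
    exact ⟨a, b, fun h => hne (by rw [h]), ha, hb, h₃, h₄⟩
  · rintro ⟨a, b, hne, h₁, h₂, h₃, h₄⟩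
    exact ⟨f a, f b, hf.ne hne, List.mem_map_of_mem h₁, List.mem_map_of_mem h₂,
      List.mem_map_of_mem h₃, List.mem_map_of_mem h₄⟩

theorem gadgetClauses_pairwise : gadgetClauses.Pairwise fun c c' => ¬ SharePair c c' := by
  have : ∀ c c' : List (ℕ × Bool), SharePair c c' → ∃ l₁ ∈ c, ∃ l₂ ∈ c, l₁ ≠ l₂ ∧ l₁ ∈ c' ∧ l₂ ∈ c' :=
    fun c c' ⟨l₁, l₂, h, h₁, h₂, h₃, h₄⟩ => ⟨l₁, h₁, l₂, h₂, h, h₃, h₄⟩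
  -- With quantifiers bounded by the clauses, the relation is decidable.
  refine List.Pairwise.imp (R := fun c c' => ∀ l₁ ∈ c, ∀ l₂ ∈ c, ¬ (l₁ ≠ l₂ ∧ l₁ ∈ c' ∧ l₂ ∈ c'))
    (fun {c c'} h hs => let ⟨l₁, h₁, l₂, h₂, h'⟩ := this c c' hs; h l₁ h₁ l₂ h₂ h') ?_
  decide

theorem fresh_injective (tag : ℕ) :
    Function.Injective fun p : ℕ × Bool => fresh tag p.1 p.2 := by
  rintro ⟨j, s⟩ ⟨j', s'⟩ h
  simpa [fresh_inj] using h

theorem mem_chain {tag : ℕ} {C c : List TemplateLiteral} :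
    c ∈ chain tag C ↔ ∃ (j : ℕ) (h : j < C.length),
      c = [fresh tag (chainIndex C.length j) false, C[j],
        fresh tag (chainIndex C.length (j + 1)) true] := by
  unfold chain
  simp only [List.mem_map, Prod.exists, List.mem_zipIdx_iff_getElem?, List.getElem?_eq_some_iff]
  constructor
  · rintro ⟨_, j, ⟨h, he⟩, rfl⟩; exact ⟨j, h, he ▸ rfl⟩
  · rintro ⟨j, h, rfl⟩; exact ⟨_, j, ⟨h, rfl⟩, rfl⟩

theorem fresh_ne {tag j : ℕ} {s : Bool} {l : TemplateLiteral} (h : Even l.code) :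
    fresh tag j s ≠ l := by
  rintro rfl
  simp [fresh, parity_simps] at h

/-- Two chain clauses can agree only in their middle literals, because the links are distinct. A
gadget clause and a chain clause have only auxiliary literals in common. For two of them, the chain
must consist of the single clause that links variable `0` to variable `1`, and no gadget clause
contains both `(0, false)` and `(1, true)`. -/
theorem convert_pairwise (tag : ℕ) {C : List TemplateLiteral} (hC : ∀ l ∈ C, Even l.code) :
    (convert tag C).Pairwise fun c c' => ¬ SharePair c c' := by
  unfold convert
  rw [List.pairwise_append]
  refine ⟨?_, ?_, ?_⟩
  · unfold gadget
    rw [List.pairwise_map]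
    exact gadgetClauses_pairwise.imp fun h => by rwa [sharePair_map (fresh_injective tag)]
  · unfold chain
    rw [List.pairwise_map, List.pairwise_iff_getElem]
    intro a b ha hb hab
    simp only [List.length_zipIdx] at ha hb
    have ha' := fun tag j s => fresh_ne (tag := tag) (j := j) (s := s) (hC _ (List.getElem_mem ha))
    have hb' := fun tag j s => fresh_ne (tag := tag) (j := j) (s := s) (hC _ (List.getElem_mem hb))
    have e₁ := chainIndex_inj (m := C.length) (j := a) (j' := b)
    have e₂ := chainIndex_inj (m := C.length) (j := a + 1) (j' := b + 1)
    have hne : a ≠ b := by omega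
    rintro ⟨l₁, l₂, hl, h₁, h₂, h₃, h₄⟩
    simp only [List.getElem_zipIdx, List.mem_cons, List.not_mem_nil, or_false, zero_add]
      at h₁ h₂ h₃ h₄
    rcases h₁ with rfl | rfl | rfl <;> rcases h₂ with rfl | rfl | rfl <;>
      simp_all [fresh_inj, eq_comm]
  · intro c hc c' hc'
    obtain ⟨j, hj, rfl⟩ := mem_chain.1 hc'
    obtain ⟨d, hd, rfl⟩ := List.mem_map.1 hc
    have ha' := fun tag j s => fresh_ne (tag := tag) (j := j) (s := s) (hC _ (List.getElem_mem hj))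
    have key : ∀ d ∈ gadgetClauses, (∀ p ∈ d, p.1 < 4) ∧ ¬ ((0, false) ∈ d ∧ (1, true) ∈ d) := by
      decide
    obtain ⟨k₁, k₂⟩ := key d hd
    rintro ⟨l₁, l₂, hl, h₁, h₂, h₃, h₄⟩
    obtain ⟨⟨p, s⟩, hp, rfl⟩ := List.mem_map.1 h₁
    obtain ⟨⟨q, r⟩, hq, rfl⟩ := List.mem_map.1 h₂
    have := k₁ _ hp
    have := k₁ _ hq
    have idx₁ : ∀ p, p < 4 → p = chainIndex C.length j → p = 0 := by
      intro p hp; unfold chainIndex; grind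
    have idx₂ : ∀ p, p < 4 → p = chainIndex C.length (j + 1) → p = 1 := by
      intro p hp; unfold chainIndex; grind
    simp only [List.mem_cons, List.not_mem_nil, or_false, fresh_inj, ha', true_and, false_or,
      ne_eq] at h₃ h₄ hl
    rcases h₃ with ⟨hp', rfl⟩ | ⟨hp', rfl⟩ <;> rcases h₄ with ⟨hq', rfl⟩ | ⟨hq', rfl⟩
    · exact hl ⟨hp'.trans hq'.symm, rfl⟩
    · rw [idx₁ p ‹_› hp'] at hp; rw [idx₂ q ‹_› hq'] at hq; exact k₂ ⟨hp, hq⟩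
    · rw [idx₂ p ‹_› hp'] at hp; rw [idx₁ q ‹_› hq'] at hq; exact k₂ ⟨hq, hp⟩
    · exact hl ⟨hp'.trans hq'.symm, rfl⟩

theorem gadgetClauses_spec : ∀ d ∈ gadgetClauses, d.length = 3 ∧ d.Nodup ∧
    ∀ p ∈ d, ∀ q ∈ d, p.1 = q.1 → p.2 = q.2 := by
  decide

/-- Each clause of a replacement has three literals, of three different variables, and at most one
of them is not auxiliary. -/
theorem convert_spec {tag : ℕ} {C c : List TemplateLiteral} (hC : ∀ l ∈ C, Even l.code)
    (hc : c ∈ convert tag C) : c.length = 3 ∧ c.Nodup ∧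
      (∀ l ∈ c, ∀ l' ∈ c, l.code = l'.code → l.sign = l'.sign) ∧
      ∀ l ∈ c, ∀ l' ∈ c, l ≠ l' → ∃ j s, l = fresh tag j s ∨ l' = fresh tag j s := by
  rcases List.mem_append.1 hc with hc | hc
  · obtain ⟨d, hd, rfl⟩ := List.mem_map.1 hc
    obtain ⟨h₁, h₂, h₃⟩ := gadgetClauses_spec d hd
    refine ⟨by simpa using h₁, h₂.map (fresh_injective tag), ?_, ?_⟩
    · intro l hl l' hl' hll
      obtain ⟨p, hp, rfl⟩ := List.mem_map.1 hl
      obtain ⟨q, hq, rfl⟩ := List.mem_map.1 hl'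
      exact h₃ p hp q hq (by simpa [fresh, Nat.pair_eq_pair] using hll)
    · intro l hl l' _ _
      obtain ⟨p, hp, rfl⟩ := List.mem_map.1 hl
      exact ⟨p.1, p.2, Or.inl rfl⟩
  · obtain ⟨j, hj, rfl⟩ := mem_chain.1 hc
    have hl := hC _ (List.getElem_mem hj)
    have e := chainIndex_inj (m := C.length) (j := j) (j' := j + 1)
    have e' := chainIndex_inj (m := C.length) (j := j + 1) (j' := j)
    have f : ∀ x, ¬ (2 * x + 1 = C[j].code) := fun x h => by
      rw [← h] at hl; simp [parity_simps] at hl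
    have f' : ∀ x, ¬ (C[j].code = 2 * x + 1) := fun x h => f x h.symm
    refine ⟨rfl, ?_, ?_, ?_⟩
    · simp [fresh_ne hl, fresh_inj, (fresh_ne hl).symm]
    · intro l hl l' hl' h
      simp only [List.mem_cons, List.not_mem_nil, or_false] at hl hl'
      rcases hl with rfl | rfl | rfl <;> rcases hl' with rfl | rfl | rfl <;>
        simp [fresh, Nat.pair_eq_pair, e, e', f, f'] at h ⊢
    · intro l hl l' hl' h
      simp only [List.mem_cons, List.not_mem_nil, or_false] at hl hl'
      rcases hl with rfl | rfl | rfl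
      · exact ⟨_, _, Or.inl rfl⟩
      · rcases hl' with rfl | rfl | rfl
        · exact ⟨_, _, Or.inr rfl⟩
        · exact absurd rfl h
        · exact ⟨_, _, Or.inr rfl⟩
      · exact ⟨_, _, Or.inl rfl⟩

theorem mem_expand {templ : ℕ → List (List TemplateLiteral)} {f : ℕ} {c : List TemplateLiteral} :
    c ∈ expand templ f ↔
      ∃ (κ : ℕ) (h : κ < (templ f).length), c ∈ convert (Nat.pair f κ) (templ f)[κ] := by
  unfold expand
  simp only [List.mem_flatMap, Prod.exists, List.mem_zipIdx_iff_getElem?,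
    List.getElem?_eq_some_iff]
  constructor
  · rintro ⟨_, κ, ⟨h, he⟩, h'⟩; exact ⟨κ, h, he ▸ h'⟩
  · rintro ⟨κ, h, h'⟩; exact ⟨_, κ, ⟨h, rfl⟩, h'⟩

variable {templ : ℕ → List (List TemplateLiteral)}

theorem mem_formulaOf {I : List (ℕ × ℕ × ℕ)} {c : Clause} :
    c ∈ formulaOf templ I ↔ ∃ f t i, (f, t, i) ∈ I ∧ ∃ (κ : ℕ) (h : κ < (templ f).length),
      ∃ d ∈ convert (Nat.pair f κ) (templ f)[κ], c = d.map (TemplateLiteral.inst t i) := by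
  unfold formulaOf block
  simp only [List.mem_flatMap, Prod.exists, List.mem_map, mem_expand]
  constructor
  · rintro ⟨f, t, i, h, d, ⟨κ, hκ, hd⟩, rfl⟩; exact ⟨f, t, i, h, κ, hκ, d, hd, rfl⟩
  · rintro ⟨f, t, i, h, κ, hκ, d, hd, rfl⟩; exact ⟨f, t, i, h, d, ⟨κ, hκ, hd⟩, rfl⟩

theorem inst_injective (t i : ℕ) : Function.Injective (TemplateLiteral.inst t i) :=
  fun _ _ h => inst_inj.1 h

theorem threeLiterals_formulaOf (I : List (ℕ × ℕ × ℕ))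
    (hev : ∀ f, ∀ C ∈ templ f, ∀ l ∈ C, Even l.code) : (formulaOf templ I).ThreeLiterals := by
  intro c hc
  obtain ⟨f, t, i, -, κ, hκ, d, hd, rfl⟩ := mem_formulaOf.1 hc
  obtain ⟨h₁, h₂, -⟩ := convert_spec (hev f _ (List.getElem_mem hκ)) hd
  exact ⟨by simpa using h₁, h₂.map (inst_injective t i)⟩

theorem noOppositeLiterals_formulaOf (I : List (ℕ × ℕ × ℕ))
    (hev : ∀ f, ∀ C ∈ templ f, ∀ l ∈ C, Even l.code) : (formulaOf templ I).NoOppositeLiterals := by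
  rintro c hc x ⟨h, h'⟩
  obtain ⟨f, t, i, -, κ, hκ, d, hd, rfl⟩ := mem_formulaOf.1 hc
  obtain ⟨-, -, h₃, -⟩ := convert_spec (hev f _ (List.getElem_mem hκ)) hd
  obtain ⟨l, hl, e⟩ := List.mem_map.1 h
  obtain ⟨l', hl', e'⟩ := List.mem_map.1 h'
  simp only [TemplateLiteral.inst, Literal.mk.injEq] at e e'
  have := h₃ l hl l' hl' (varNum_inj.1 (e.1.trans e'.1.symm)).1
  rw [e.2, e'.2] at this
  cases this

/-- The name of an auxiliary variable contains the tag of its clause and the position, and its odd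
code keeps it apart from the original variables. So it occurs in one replacement only. -/
theorem fresh_inst_mem {f κ t i f' κ' t' i' j : ℕ} {s : Bool} {C : List TemplateLiteral}
    {d : List TemplateLiteral} (hC : ∀ l ∈ C, Even l.code)
    (hd : d ∈ convert (Nat.pair f' κ') C)
    (h : (fresh (Nat.pair f κ) j s).inst t i ∈ d.map (TemplateLiteral.inst t' i')) :
    f = f' ∧ κ = κ' ∧ t = t' ∧ i = i' := by
  obtain ⟨l, hl, e⟩ := List.mem_map.1 h
  simp only [TemplateLiteral.inst, Literal.mk.injEq, varNum_inj, fresh] at e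
  have aux : ∀ j s, l = fresh (Nat.pair f' κ') j s → f = f' ∧ κ = κ' ∧ t = t' ∧ i = i' := by
    rintro j s rfl
    simp [fresh, Nat.pair_eq_pair] at e
    omega
  rcases List.mem_append.1 hd with hc | hc
  · obtain ⟨g, hg, rfl⟩ := List.mem_map.1 hc
    obtain ⟨p, hp, rfl⟩ := List.mem_map.1 hl
    exact aux _ _ rfl
  · obtain ⟨j', hj, rfl⟩ := mem_chain.1 hc
    have hev := hC _ (List.getElem_mem hj)
    simp only [List.mem_cons, List.not_mem_nil, or_false] at hl
    rcases hl with h | h | h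
    · exact aux _ _ h
    · rw [← h, e.1.1] at hev
      simp [parity_simps] at hev
    · exact aux _ _ h

/-- Of two distinct literals in a clause of a replacement, one is auxiliary, and this one already
identifies the replacement. -/
theorem sharePair_tags {f κ t i f' κ' t' i' : ℕ} {C C' d d' : List TemplateLiteral}
    (hC : ∀ l ∈ C, Even l.code) (hC' : ∀ l ∈ C', Even l.code)
    (hd : d ∈ convert (Nat.pair f κ) C) (hd' : d' ∈ convert (Nat.pair f' κ') C')
    (h : SharePair (d.map (TemplateLiteral.inst t i)) (d'.map (TemplateLiteral.inst t' i'))) :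
    f = f' ∧ κ = κ' ∧ t = t' ∧ i = i' := by
  obtain ⟨l₁, l₂, hl, h₁, h₂, h₃, h₄⟩ := h
  obtain ⟨l, hl₁, rfl⟩ := List.mem_map.1 h₁
  obtain ⟨l', hl₂, rfl⟩ := List.mem_map.1 h₂
  obtain ⟨-, -, -, hs⟩ := convert_spec hC hd
  obtain ⟨j, s, rfl | rfl⟩ := hs l hl₁ l' hl₂ (fun h => hl (by rw [h]))
  · exact fresh_inst_mem hC' hd' h₃
  · exact fresh_inst_mem hC' hd' h₄

theorem pairsAtMostOnce_formulaOf {I : List (ℕ × ℕ × ℕ)} (hI : I.Nodup)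
    (hev : ∀ f, ∀ C ∈ templ f, ∀ l ∈ C, Even l.code) : (formulaOf templ I).PairsAtMostOnce := by
  apply countP_le_one_of_pairwise
  unfold formulaOf
  rw [List.pairwise_flatMap]
  constructor
  · rintro ⟨f, t, i⟩ -
    unfold block
    rw [List.pairwise_map]
    refine List.Pairwise.imp (R := fun c c' => ¬ SharePair c c')
      (fun h => by rwa [sharePair_map (inst_injective t i)]) ?_
    unfold expand
    rw [List.pairwise_flatMap]
    constructor
    · rintro ⟨C, κ⟩ hp
      exact convert_pairwise _ (hev f _ (List.mem_of_getElem? (List.mem_zipIdx_iff_getElem?.1 hp)))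
    · rw [List.pairwise_iff_getElem]
      intro a b ha hb hab c hc c' hc' hs
      simp only [List.length_zipIdx] at ha hb
      simp only [List.getElem_zipIdx, zero_add] at hc hc'
      have := sharePair_tags (t := t) (i := i) (t' := t) (i' := i)
        (hev f _ (List.getElem_mem ha)) (hev f _ (List.getElem_mem hb)) hc hc'
        ((sharePair_map (inst_injective t i)).2 hs)
      omega
  · refine hI.imp ?_
    rintro ⟨f, t, i⟩ ⟨f', t', i'⟩ hne c hc c' hc' hs
    obtain ⟨d, hd, rfl⟩ := List.mem_map.1 hc
    obtain ⟨d', hd', rfl⟩ := List.mem_map.1 hc'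
    obtain ⟨κ, hκ, hd⟩ := mem_expand.1 hd
    obtain ⟨κ', hκ', hd'⟩ := mem_expand.1 hd'
    obtain ⟨rfl, -, rfl, rfl⟩ := sharePair_tags (hev f _ (List.getElem_mem hκ))
      (hev f' _ (List.getElem_mem hκ')) hd hd' hs
    exact hne rfl

/-! ### Satisfiability -/

/-- Write a, b, c, d for the variables 0, 1, 2, 3. If b were true, then a → c → d → a, so the first
clause would make all of them true, against {¬a, ¬c, ¬d}. With b false, falsity of a would force c
and then d to be false, against the first clause. -/
theorem gadget_forces (v : ℕ → Bool) (h : ∀ d ∈ gadgetClauses, ∃ p ∈ d, v p.1 = p.2) :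
    v 0 = true ∧ v 1 = false := by
  simp only [gadgetClauses, List.forall_mem_cons, List.exists_mem_cons_iff] at h
  simp at h
  revert h
  generalize v 0 = a; generalize v 1 = b; generalize v 2 = c; generalize v 3 = d
  revert a b c d
  simp only [Bool.forall_bool]
  simp

theorem gadget_satisfied : ∀ d ∈ gadgetClauses, ∃ p ∈ d, decide (p.1 = 0) = p.2 := by
  decide

/-- The assignment `v` makes the template literal true at the position `(t, i)`. -/
def TemplateLiteral.Holds (u : ℕ → ℕ → ℕ → Bool) (t i : ℕ) (l : TemplateLiteral) : Prop :=
  u l.code (t + l.dt) (i + l.di) = l.sign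

/-- If every literal of `C` fails, truth propagates along the links from variable `0` to variable
`1`, which the gadget makes false. For empty `C` the chain would be empty and impose nothing. -/
theorem convert_sound {u : ℕ → ℕ → ℕ → Bool} {tag t i : ℕ} {C : List TemplateLiteral}
    (hC : C ≠ []) (h : ∀ c ∈ convert tag C, ∃ l ∈ c, l.Holds u t i) : ∃ l ∈ C, l.Holds u t i := by
  by_contra hno
  push Not at hno
  let w : ℕ → Bool := fun j => u (2 * Nat.pair tag j + 1) t i
  have hw : w 0 = true ∧ w 1 = false := by
    apply gadget_forces
    intro d hd
    obtain ⟨l, hl, hl'⟩ := h _ (List.mem_append_left _ (List.mem_map_of_mem hd))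
    obtain ⟨p, hp, rfl⟩ := List.mem_map.1 hl
    exact ⟨p, hp, hl'⟩
  have hchain : ∀ j ≤ C.length, w (chainIndex C.length j) = true := by
    intro j
    induction j with
    | zero => intro _; simpa [chainIndex] using hw.1
    | succ j ih =>
      intro hj
      have ih := ih (by omega)
      obtain ⟨l, hl, hl'⟩ := h _ (List.mem_append_right _ (mem_chain.2 ⟨j, hj, rfl⟩))
      simp only [List.mem_cons, List.not_mem_nil, or_false] at hl
      rcases hl with rfl | rfl | rfl
      · have : w (chainIndex C.length j) = false := hl'
        rw [this] at ih; cases ih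
      · exact absurd hl' (hno _ (List.getElem_mem _))
      · exact hl'
  have h1 := hchain _ le_rfl
  have hpos : C.length ≠ 0 := by simpa using hC
  rw [chainIndex, if_neg hpos, if_pos rfl, hw.2] at h1
  cases h1

open Classical in
/-- The extension to the auxiliary variables of an assignment to the variables with even codes. -/
noncomputable def extendAssignment (templ : ℕ → List (List TemplateLiteral))
    (u : ℕ → ℕ → ℕ → Bool) (c t i : ℕ) : Bool :=
  if Even c then u c t i else
    let q := (c / 2).unpair
    let j := q.2
    let C := (templ q.1.unpair.1).getD q.1.unpair.2 []
    if j < 4 then decide (j = 0)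
    else decide (∀ l ∈ C.take (j - 4), ¬ l.Holds u t i)

theorem extendAssignment_fresh (u : ℕ → ℕ → ℕ → Bool) {f κ j t i : ℕ} (hκ : κ < (templ f).length) :
    extendAssignment templ u (2 * Nat.pair (Nat.pair f κ) j + 1) t i = true ↔
      if j < 4 then j = 0 else ∀ l ∈ (templ f)[κ].take (j - 4), ¬ l.Holds u t i := by
  have h : (2 * Nat.pair (Nat.pair f κ) j + 1) / 2 = Nat.pair (Nat.pair f κ) j := by omega
  have h' : ¬ Even (2 * Nat.pair (Nat.pair f κ) j + 1) := by simp [parity_simps]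
  unfold extendAssignment
  rw [if_neg h', h]
  classical
  by_cases h4 : j < 4
  · simp [h4]
  · simp only [Nat.unpair_pair, h4, if_false]
    rw [decide_eq_true_iff]
    rw [List.getD_eq_getElem _ _ hκ]

/-- The interior links have this value by definition. The last link is the gadget variable `1`,
which is false, and this agrees because some literal of the clause holds. -/
theorem extendAssignment_chain (u : ℕ → ℕ → ℕ → Bool) {f κ j t i : ℕ} (hκ : κ < (templ f).length)
    (hj : j ≤ (templ f)[κ].length) (h : ∃ l ∈ (templ f)[κ], l.Holds u t i) :
    extendAssignment templ u
        (2 * Nat.pair (Nat.pair f κ) (chainIndex (templ f)[κ].length j) + 1) t i = true ↔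
      ∀ l ∈ (templ f)[κ].take j, ¬ l.Holds u t i := by
  rw [extendAssignment_fresh u hκ]
  unfold chainIndex
  by_cases h0 : j = 0
  · simp [h0]
  by_cases h1 : j = (templ f)[κ].length
  · subst h1
    simpa [h0] using h
  · simp [h0, h1]

theorem convert_complete {u : ℕ → ℕ → ℕ → Bool} {f κ t i : ℕ} (hκ : κ < (templ f).length)
    (hev : ∀ l ∈ (templ f)[κ], Even l.code) (h : ∃ l ∈ (templ f)[κ], l.Holds u t i)
    {c : List TemplateLiteral} (hc : c ∈ convert (Nat.pair f κ) (templ f)[κ]) :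
    ∃ l ∈ c, l.Holds (extendAssignment templ u) t i := by
  rcases List.mem_append.1 hc with hc | hc
  · obtain ⟨d, hd, rfl⟩ := List.mem_map.1 hc
    obtain ⟨p, hp, hp'⟩ := gadget_satisfied d hd
    refine ⟨_, List.mem_map_of_mem hp, ?_⟩
    have hlt : ∀ d ∈ gadgetClauses, ∀ p ∈ d, p.1 < 4 := by decide
    have := extendAssignment_fresh u (j := p.1) (t := t) (i := i) hκ
    rw [if_pos (hlt d hd p hp)] at this
    simp only [TemplateLiteral.Holds, fresh, add_zero]
    rw [← hp', Bool.eq_iff_iff, this, decide_eq_true_iff]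
  · obtain ⟨j, hj, rfl⟩ := mem_chain.1 hc
    have h₁ := extendAssignment_chain u hκ hj.le h
    have h₂ := extendAssignment_chain u hκ (Nat.succ_le_of_lt hj) h
    by_cases hp : ∀ l ∈ (templ f)[κ].take j, ¬ l.Holds u t i
    · by_cases hl : (templ f)[κ][j].Holds u t i
      · refine ⟨_, List.mem_cons_of_mem _ List.mem_cons_self, ?_⟩
        have := hev _ (List.getElem_mem hj)
        simp only [TemplateLiteral.Holds] at hl ⊢
        rw [extendAssignment, if_pos this, hl]
      · refine ⟨_, List.mem_cons_of_mem _ (List.mem_cons_of_mem _ List.mem_cons_self), ?_⟩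
        refine h₂.2 fun l hl' => ?_
        rw [List.take_succ_eq_append_getElem hj, List.mem_append, List.mem_singleton] at hl'
        rcases hl' with hl' | rfl
        · exact hp l hl'
        · exact hl
    · refine ⟨_, List.mem_cons_self, ?_⟩
      have h₃ := (not_congr h₁).2 hp
      simpa [TemplateLiteral.Holds, fresh] using h₃

theorem satisfiable_formulaOf {I : List (ℕ × ℕ × ℕ)}
    (hev : ∀ f, ∀ C ∈ templ f, ∀ l ∈ C, Even l.code) (hne : ∀ f, ∀ C ∈ templ f, C ≠ []) :
    (formulaOf templ I).Satisfiable ↔ ∃ u : ℕ → ℕ → ℕ → Bool,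
      ∀ f t i, (f, t, i) ∈ I → ∀ C ∈ templ f, ∃ l ∈ C, l.Holds u t i := by
  constructor
  · rintro ⟨v, hv⟩
    refine ⟨fun c t i => v (varNum c t i), fun f t i hI C hC => ?_⟩
    obtain ⟨κ, hκ, rfl⟩ := List.getElem_of_mem hC
    refine convert_sound (tag := Nat.pair f κ) (hne f _ hC) fun c hc => ?_
    obtain ⟨l, hl, hl'⟩ := hv _ (mem_formulaOf.2 ⟨f, t, i, hI, κ, hκ, c, hc, rfl⟩)
    obtain ⟨l, hlc, rfl⟩ := List.mem_map.1 hl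
    exact ⟨l, hlc, hl'⟩
  · rintro ⟨u, hu⟩
    have hinj : Function.Injective fun p : ℕ × ℕ × ℕ => varNum p.1 p.2.1 p.2.2 := by
      rintro ⟨c, t, i⟩ ⟨c', t', i'⟩ h
      simpa [varNum_inj] using h
    -- By injectivity of `varNum` the triple can be recovered from the number; values at other
    -- numbers are irrelevant.
    refine ⟨fun x => let p := Function.invFun (fun p : ℕ × ℕ × ℕ => varNum p.1 p.2.1 p.2.2) x
      extendAssignment templ u p.1 p.2.1 p.2.2, fun c hc => ?_⟩
    obtain ⟨f, t, i, hI, κ, hκ, d, hd, rfl⟩ := mem_formulaOf.1 hc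
    obtain ⟨l, hl, hl'⟩ := convert_complete hκ (hev f _ (List.getElem_mem hκ))
      (hu f t i hI _ (List.getElem_mem hκ)) hd
    refine ⟨_, List.mem_map_of_mem hl, ?_⟩
    have := Function.leftInverse_invFun hinj (l.code, t + l.dt, i + l.di)
    simp only [Literal.IsTrue, TemplateLiteral.inst] at this ⊢
    rw [this]
    exact hl'

end SatVariant

/-! ### Tilings expressed by clauses. -/

namespace SatVariant

/-! ### Tilings -/

/-- Constraints on a tiling of a quadrant by tiles from `D`: on neighbours in a row, on neighbours
in a column, and on the tiles in row `0` at the places of the input, at the places of the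
certificate, at the first place after it, and at the first place. -/
structure TilingSystem (D : Type) where
  hor : D → D → Prop
  ver : D → D → Prop
  symb : Bool → D → Prop
  cert : D → Prop
  blank : D → Prop
  left : D → Prop

namespace TilingSystem

variable {D : Type} (W : TilingSystem D)

/-- The constraints on row `0` for the input `x` and `P` places for the certificate. -/
structure Starts (x : List Bool) (P : ℕ) (r : ℕ → D) : Prop where
  symb : ∀ i, ∀ h : i < x.length, W.symb x[i] (r i)
  cert : ∀ j < P, W.cert (r (x.length + j))
  blank : W.blank (r (x.length + P))
  left : W.left (r 0)

variable [Fintype D]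

/-- The variable for the tile `d` at a place, or its negation. -/
noncomputable def tileLiteral (s : Bool) (d : D) (dt di : ℕ) : TemplateLiteral :=
  ⟨s, 2 * (Fintype.equivFin D d : ℕ), dt, di⟩

open Classical in
/-- Clauses that exclude all tiles without the property `p`. -/
noncomputable def exclude (p : D → Prop) : List (List TemplateLiteral) :=
  (Finset.univ.filter fun d => ¬ p d).toList.map fun d => [tileLiteral false d 0 0]

open Classical in
/-- Clauses that exclude all pairs of tiles that are not in the relation `p`. -/
noncomputable def excludePairs (p : D → D → Prop) (dt di : ℕ) : List (List TemplateLiteral) :=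
  (Finset.univ.filter fun d : D × D => ¬ p d.1 d.2).toList.map fun d =>
    [tileLiteral false d.1 0 0, tileLiteral false d.2 dt di]

/-- The families of clauses for a tiling system. -/
noncomputable def templ : ℕ → List (List TemplateLiteral)
  | 0 => exclude (W.symb false)
  | 1 => exclude (W.symb true)
  | 2 => exclude W.cert
  | 3 => exclude W.blank
  | 4 => exclude W.left
  | 5 => (Finset.univ.toList.map fun d : D => tileLiteral true d 0 0) ::
      (excludePairs W.hor 0 1 ++ excludePairs W.ver 1 0)
  | _ => []

/-- The families and their positions for the input `x`, `P` places for the certificate and a square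
with side `T`. -/
def instances (x : List Bool) (P T : ℕ) : List (ℕ × ℕ × ℕ) :=
  (x.zipIdx.map fun p => (p.1.toNat, 0, p.2)) ++
    (((List.range P).map fun j => (2, 0, x.length + j)) ++
      ([(3, 0, x.length + P), (4, 0, 0)] ++
        (List.range T).flatMap fun t => (List.range T).map fun i => (5, t, i)))

/-- Auxiliary variables are private only if no family is placed twice at the same position. -/
theorem nodup_instances (x : List Bool) (P T : ℕ) : (instances x P T).Nodup := by
  unfold instances
  refine List.Nodup.append ?_ (List.Nodup.append ?_ (List.Nodup.append ?_ ?_ ?_) ?_) ?_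
  · refine List.Nodup.of_map (fun p : ℕ × ℕ × ℕ => p.2.2) ?_
    rw [List.map_map]
    have : ((fun p : ℕ × ℕ × ℕ => p.2.2) ∘ fun p : Bool × ℕ => (p.1.toNat, 0, p.2)) = Prod.snd := rfl
    rw [this, List.zipIdx_map_snd]
    exact List.nodup_range'
  · refine List.nodup_range.map fun a b h => ?_
    simpa using h
  · simp
  · rw [List.nodup_flatMap]
    refine ⟨fun t _ => List.nodup_range.map fun a b h => by simpa using h, ?_⟩
    refine List.nodup_range.imp fun {a b} hab => ?_
    intro p hp hq
    simp only [List.mem_map] at hp hq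
    obtain ⟨i, -, rfl⟩ := hp
    obtain ⟨j, -, h⟩ := hq
    simp at h
    exact hab h.1.symm
  · intro p hp hq
    simp only [List.mem_flatMap, List.mem_map] at hq
    obtain ⟨t, -, i, -, rfl⟩ := hq
    simp at hp
  · intro p hp hq
    simp only [List.mem_map] at hp
    obtain ⟨j, -, rfl⟩ := hp
    simp at hq
  · intro p hp hq
    simp only [List.mem_map, Prod.exists] at hp
    obtain ⟨b, j, -, rfl⟩ := hp
    cases b <;> simp at hq

theorem mem_exclude {p : D → Prop} {C : List TemplateLiteral} :
    C ∈ exclude p ↔ ∃ d, ¬ p d ∧ C = [tileLiteral false d 0 0] := by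
  simp [exclude, eq_comm]

theorem mem_excludePairs {p : D → D → Prop} {dt di : ℕ} {C : List TemplateLiteral} :
    C ∈ excludePairs p dt di ↔
      ∃ d e, ¬ p d e ∧ C = [tileLiteral false d 0 0, tileLiteral false e dt di] := by
  simp [excludePairs, eq_comm]

theorem mem_templ {f : ℕ} {C : List TemplateLiteral} (h : C ∈ W.templ f) :
    (∃ p, C ∈ exclude (D := D) p) ∨ (∃ p dt di, C ∈ excludePairs (D := D) p dt di) ∨
      C = Finset.univ.toList.map fun d : D => tileLiteral true d 0 0 := by
  unfold templ at h
  split at h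
  any_goals exact Or.inl ⟨_, h⟩
  · rw [List.mem_cons, List.mem_append] at h
    rcases h with rfl | h | h
    · exact Or.inr (Or.inr rfl)
    · exact Or.inr (Or.inl ⟨_, _, _, h⟩)
    · exact Or.inr (Or.inl ⟨_, _, _, h⟩)
  · simp at h

theorem even_templ (f : ℕ) : ∀ C ∈ W.templ f, ∀ l ∈ C, Even l.code := by
  have key : ∀ s (d : D) dt di, Even (tileLiteral s d dt di).code := fun s d dt di => by
    simp [tileLiteral]
  intro C hC l hl
  rcases W.mem_templ hC with ⟨p, h⟩ | ⟨p, dt, di, h⟩ | rfl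
  · obtain ⟨d, -, rfl⟩ := mem_exclude.1 h
    rw [List.mem_singleton] at hl
    exact hl ▸ key _ _ _ _
  · obtain ⟨d, e, -, rfl⟩ := mem_excludePairs.1 h
    simp only [List.mem_cons, List.not_mem_nil, or_false] at hl
    rcases hl with rfl | rfl <;> exact key _ _ _ _
  · obtain ⟨d, -, rfl⟩ := List.mem_map.1 hl
    exact key _ _ _ _

theorem templ_ne_nil [Nonempty D] (f : ℕ) : ∀ C ∈ W.templ f, C ≠ [] := by
  intro C hC
  rcases W.mem_templ hC with ⟨p, h⟩ | ⟨p, dt, di, h⟩ | rfl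
  · obtain ⟨d, -, rfl⟩ := mem_exclude.1 h
    simp
  · obtain ⟨d, e, -, rfl⟩ := mem_excludePairs.1 h
    simp
  · simpa using Finset.univ_nonempty.ne_empty

/-- The formula for the input `x`. -/
noncomputable def formula (x : List Bool) (P T : ℕ) : Formula :=
  formulaOf W.templ (instances x P T)

theorem exclude_sound {p : D → Prop} {u : ℕ → ℕ → ℕ → Bool} {t i : ℕ}
    (h : ∀ C ∈ exclude p, ∃ l ∈ C, l.Holds u t i) {d : D}
    (hd : (tileLiteral true d 0 0).Holds u t i) : p d := by
  by_contra hp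
  obtain ⟨l, hl, hl'⟩ := h _ (mem_exclude.2 ⟨d, hp, rfl⟩)
  rw [List.mem_singleton] at hl
  subst hl
  have h₁ : _ = true := hd
  have h₂ : _ = false := hl'
  exact Bool.noConfusion (h₁.symm.trans h₂)

theorem excludePairs_sound {p : D → D → Prop} {u : ℕ → ℕ → ℕ → Bool} {t i dt di : ℕ}
    (h : ∀ C ∈ excludePairs p dt di, ∃ l ∈ C, l.Holds u t i) {d e : D}
    (hd : (tileLiteral true d 0 0).Holds u t i)
    (he : (tileLiteral true e 0 0).Holds u (t + dt) (i + di)) : p d e := by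
  by_contra hp
  obtain ⟨l, hl, hl'⟩ := h _ (mem_excludePairs.2 ⟨d, e, hp, rfl⟩)
  simp only [List.mem_cons, List.not_mem_nil, or_false] at hl
  rcases hl with rfl | rfl
  · have h₁ : _ = true := hd
    have h₂ : _ = false := hl'
    exact Bool.noConfusion (h₁.symm.trans h₂)
  · have h₁ : _ = true := he
    have h₂ : _ = false := hl'
    exact Bool.noConfusion (h₁.symm.trans h₂)

/-- No clause forbids several tiles at one place. This is harmless: the excluding clauses constrain
all tiles whose variables are true, so any choice among them gives a tiling. -/
theorem exists_tiling [Nonempty D] {x : List Bool} {P T : ℕ} (hT : x.length + P < T)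
    (h : (W.formula x P T).Satisfiable) : ∃ τ : ℕ → ℕ → D, W.Starts x P (τ 0) ∧
      (∀ t i, t < T → i + 1 < T → W.hor (τ t i) (τ t (i + 1))) ∧
      ∀ t i, t + 1 < T → i < T → W.ver (τ t i) (τ (t + 1) i) := by
  obtain ⟨u, hu⟩ := (satisfiable_formulaOf W.even_templ W.templ_ne_nil).1 h
  have hmain : ∀ t i, t < T → i < T → (5, t, i) ∈ instances x P T := by
    intro t i ht hi
    simp [instances, ht, hi]
  have hex : ∀ t i, ∃ d : D, t < T → i < T → (tileLiteral true d 0 0).Holds u t i := by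
    intro t i
    by_cases ht : t < T ∧ i < T
    · obtain ⟨l, hl, hl'⟩ := hu 5 t i (hmain t i ht.1 ht.2) _ List.mem_cons_self
      obtain ⟨d, -, rfl⟩ := List.mem_map.1 hl
      exact ⟨d, fun _ _ => hl'⟩
    · exact ⟨Classical.arbitrary D, fun h h' => absurd ⟨h, h'⟩ ht⟩
  choose τ hτ using hex
  refine ⟨τ, ⟨fun i hi => ?_, fun j hj => ?_, ?_, ?_⟩, fun t i ht hi => ?_, fun t i ht hi => ?_⟩
  · have hI : (x[i].toNat, 0, i) ∈ instances x P T := by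
      unfold instances
      refine List.mem_append_left _ (List.mem_map.2 ⟨(x[i], i), ?_, rfl⟩)
      rw [List.mem_zipIdx_iff_getElem?]
      simp
    have := hu _ _ _ hI
    refine exclude_sound (?_ : ∀ C ∈ exclude (W.symb x[i]), _) (hτ 0 i (by omega) (by omega))
    cases hx : x[i] <;> rw [hx] at this <;> exact this
  · exact exclude_sound (hu 2 0 (x.length + j) (by simp [instances, hj]))
      (hτ _ _ (by omega) (by omega))
  · exact exclude_sound (hu 3 0 (x.length + P) (by simp [instances])) (hτ _ _ (by omega) (by omega))
  · exact exclude_sound (hu 4 0 0 (by simp [instances])) (hτ _ _ (by omega) (by omega))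
  · exact excludePairs_sound
      (fun C hC => hu 5 t i (hmain t i ht (by omega)) C
        (List.mem_cons_of_mem _ (List.mem_append_left _ hC)))
      (hτ t i ht (by omega)) (hτ t (i + 1) ht hi)
  · exact excludePairs_sound
      (fun C hC => hu 5 t i (hmain t i (by omega) hi) C
        (List.mem_cons_of_mem _ (List.mem_append_right _ hC)))
      (hτ t i (by omega) hi) (hτ (t + 1) i ht hi)

open Classical in
/-- The assignment that describes a tiling. -/
noncomputable def assignment (τ : ℕ → ℕ → D) (c t i : ℕ) : Bool :=
  decide (c = 2 * (Fintype.equivFin D (τ t i) : ℕ))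

theorem tileLiteral_holds {τ : ℕ → ℕ → D} {s : Bool} {d : D} {dt di t i : ℕ} :
    (tileLiteral s d dt di).Holds (assignment τ) t i ↔
      (s = true ↔ d = τ (t + dt) (i + di)) := by
  have : 2 * (Fintype.equivFin D d : ℕ) = 2 * Fintype.equivFin D (τ (t + dt) (i + di)) ↔
      d = τ (t + dt) (i + di) := by
    rw [Nat.mul_right_inj two_ne_zero, Fin.val_inj, EmbeddingLike.apply_eq_iff_eq]
  unfold TemplateLiteral.Holds assignment tileLiteral
  cases s
  · rw [decide_eq_false_iff_not]
    exact (not_congr this).trans (by simp)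
  · rw [decide_eq_true_iff]
    exact this.trans (by simp)

theorem exclude_complete {p : D → Prop} {τ : ℕ → ℕ → D} {t i : ℕ} (h : p (τ t i)) :
    ∀ C ∈ exclude p, ∃ l ∈ C, l.Holds (assignment τ) t i := by
  intro C hC
  obtain ⟨d, hd, rfl⟩ := mem_exclude.1 hC
  refine ⟨_, List.mem_cons_self, tileLiteral_holds.2 ?_⟩
  simp only [Bool.false_eq_true, false_iff]
  rintro rfl
  exact hd h

theorem excludePairs_complete {p : D → D → Prop} {τ : ℕ → ℕ → D} {t i dt di : ℕ}
    (h : p (τ t i) (τ (t + dt) (i + di))) :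
    ∀ C ∈ excludePairs p dt di, ∃ l ∈ C, l.Holds (assignment τ) t i := by
  intro C hC
  obtain ⟨d, e, hd, rfl⟩ := mem_excludePairs.1 hC
  by_cases h' : d = τ t i
  · refine ⟨_, List.mem_cons_of_mem _ List.mem_cons_self, tileLiteral_holds.2 ?_⟩
    simp only [Bool.false_eq_true, false_iff]
    rintro rfl
    exact hd (h' ▸ h)
  · refine ⟨_, List.mem_cons_self, tileLiteral_holds.2 ?_⟩
    simpa using h'

/-- The constraints are assumed on the whole quadrant because clauses at the border of the square
also mention row `T` and column `T`. -/
theorem satisfiable_of_tiling [Nonempty D] {x : List Bool} {P T : ℕ} {τ : ℕ → ℕ → D}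
    (h₀ : W.Starts x P (τ 0)) (hh : ∀ t i, W.hor (τ t i) (τ t (i + 1)))
    (hv : ∀ t i, W.ver (τ t i) (τ (t + 1) i)) : (W.formula x P T).Satisfiable := by
  refine (satisfiable_formulaOf W.even_templ W.templ_ne_nil).2
    ⟨assignment τ, fun f t i hI => ?_⟩
  unfold instances at hI
  simp only [List.mem_append, List.mem_map, List.mem_flatMap, List.mem_cons, List.not_mem_nil,
    or_false, Prod.mk.injEq, Prod.exists, List.mem_zipIdx_iff_getElem?, List.mem_range,
    List.getElem?_eq_some_iff] at hI
  rcases hI with ⟨b, j, ⟨hj, hb⟩, rfl, rfl, rfl⟩ | ⟨j, hj, rfl, rfl, rfl⟩ |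
    (⟨rfl, rfl, rfl⟩ | ⟨rfl, rfl, rfl⟩) | ⟨t, ht, i, hi, rfl, rfl, rfl⟩
  · have := h₀.symb j hj
    rw [hb] at this
    cases b <;> exact exclude_complete this
  · exact exclude_complete (h₀.cert j hj)
  · exact exclude_complete h₀.blank
  · exact exclude_complete h₀.left
  · intro C hC
    rcases List.mem_cons.1 hC with rfl | hC
    · refine ⟨tileLiteral true (τ t i) 0 0, List.mem_map_of_mem (by simp), ?_⟩
      simp [tileLiteral_holds]
    · rcases List.mem_append.1 hC with hC | hC
      · exact excludePairs_complete (hh t i) C hC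
      · exact excludePairs_complete (hv t i) C hC

end TilingSystem
end SatVariant

/-! ### Space-time diagrams of stack machines. -/

namespace SatVariant

/-! ### Iterating partial functions -/

/-- The result of `n` steps of `f` from `c`, if they exist. -/
def iter {α : Type*} (f : α → Option α) (n : ℕ) (c : α) : Option α := (flip bind f)^[n] (some c)

theorem iter_zero {α : Type*} (f : α → Option α) (c : α) : iter f 0 c = some c := rfl

theorem iter_succ {α : Type*} (f : α → Option α) (n : ℕ) (c : α) :
    iter f (n + 1) c = (iter f n c).bind f := by
  unfold iter
  rw [Function.iterate_succ_apply']
  rfl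

theorem iter_add {α : Type*} {f : α → Option α} {n : ℕ} {c d : α} (h : iter f n c = some d)
    (m : ℕ) : iter f (n + m) c = iter f m d := by
  induction m with
  | zero => exact h
  | succ m ih => rw [← add_assoc, iter_succ, ih, iter_succ]

theorem iter_one {α : Type*} (f : α → Option α) (c : α) : iter f 1 c = f c := by
  rw [iter_succ, iter_zero]; rfl

theorem iter_ne_none_of_le {α : Type*} {f : α → Option α} {n m : ℕ} {c : α}
    (h : iter f n c ≠ none) (hm : m ≤ n) : iter f m c ≠ none := by
  induction n with
  | zero => obtain rfl : m = 0 := by omega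
            exact h
  | succ n ih =>
    rcases Nat.lt_or_ge m (n + 1) with h' | h'
    · refine ih (fun h₀ => h ?_) (by omega)
      rw [iter_succ, h₀]; rfl
    · obtain rfl : m = n + 1 := by omega
      exact h

/-! ### Small steps of a machine with stacks -/

namespace Micro

open Turing

variable {K : Type} {Γ : K → Type} {Λ σ : Type}

/-- The symbols at some depth in all stacks. -/
abbrev Column (Γ : K → Type) : Type := ∀ k, Option (Γ k)

/-- The rest of the statement that is executed, `none` after halting, and the internal state. -/
abbrev Control (Γ : K → Type) (Λ σ : Type) : Type := Option (TM2.Stmt Γ Λ σ) × σ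

/-- The contents of all stacks. -/
abbrev Stacks (Γ : K → Type) : Type := ∀ k, List (Γ k)

/-- The symbols at depth `i`. -/
def col (S : Stacks Γ) (i : ℕ) : Column Γ := fun k => (S k)[i]?

/-- The symbols just above depth `i`. -/
def leftCol (S : Stacks Γ) : ℕ → Option (Column Γ)
  | 0 => none
  | i + 1 => some (col S i)

open Classical in
/-- The control part of a small step. After halting, the machine continues only if the top of the
stacks has the property `ok`. -/
noncomputable def ctrl (M : Λ → TM2.Stmt Γ Λ σ) (ok : Column Γ → Prop) :
    Control Γ Λ σ → Column Γ → Option (Control Γ Λ σ)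
  | (none, v), c => if ok c then some (none, v) else none
  | (some (.push _ _ s), v), _ => some (some s, v)
  | (some (.peek k f s), v), c => some (some s, f v (c k))
  | (some (.pop k f s), v), c => some (some s, f v (c k))
  | (some (.load f s), v), _ => some (some s, f v)
  | (some (.branch f s s'), v), _ => some (some (cond (f v) s s'), v)
  | (some (.goto f), v), _ => some (some (M (f v)), v)
  | (some .halt, v), _ => some (none, v)

theorem head?_eq_col (S : Stacks Γ) (k : K) : (S k).head? = col S 0 k := by
  simp [col, List.head?_eq_getElem?]

section

variable [Fintype Λ]

/-- The statements that can occur as the rest of the statement that is executed. -/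
abbrev Rest (M : Λ → TM2.Stmt Γ Λ σ) : Type :=
  {s : Option (TM2.Stmt Γ Λ σ) // s ∈ TM2.stmts M Finset.univ}

/-- A place in the space-time diagram of a machine: the symbols at this depth, at the previous and
at the next one, and the control. -/
structure Tile (M : Λ → TM2.Stmt Γ Λ σ) where
  left : Option (Column Γ)
  mid : Column Γ
  right : Column Γ
  rest : Rest M
  var : σ

/-- The control at a place. -/
def Tile.control {M : Λ → TM2.Stmt Γ Λ σ} (d : Tile M) : Control Γ Λ σ := (d.rest.1, d.var)

/-- The type of all statements may be infinite, but only the finitely many substatements of the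
program can remain to be executed. `ctrl_mem_stmts` shows that small steps stay among them. -/
theorem finite_tile (M : Λ → TM2.Stmt Γ Λ σ) [Fintype K] [∀ k, Finite (Γ k)] [Finite σ] : Finite (Tile M) := by
  let f : Tile M → Option (Column Γ) × Column Γ × Column Γ × Rest M × σ :=
    fun d => (d.left, d.mid, d.right, d.rest, d.var)
  refine Finite.of_injective f ?_
  rintro ⟨⟩ ⟨⟩ h
  simp only [f, Prod.mk.injEq] at h
  obtain ⟨rfl, rfl, rfl, rfl, rfl⟩ := h
  rfl

theorem ctrl_mem_stmts {M : Λ → TM2.Stmt Γ Λ σ} {ok : Column Γ → Prop}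
    {q q' : Control Γ Λ σ} {c : Column Γ} (h : ctrl M ok q c = some q')
    (hq : q.1 ∈ TM2.stmts M Finset.univ) : q'.1 ∈ TM2.stmts M Finset.univ := by
  have hM : ∀ l, some (M l) ∈ TM2.stmts M Finset.univ := fun l => by
    simp only [TM2.stmts, Finset.some_mem_insertNone, Finset.mem_biUnion]
    exact ⟨l, Finset.mem_univ _, TM2.stmts₁_self⟩
  have hN : none ∈ TM2.stmts M Finset.univ := by simp [TM2.stmts]
  obtain ⟨s | s, v⟩ := q
  · simp only [ctrl] at h
    split_ifs at h
    cases h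
    exact hq
  · cases s with
    | branch f s s' =>
      cases h
      refine TM2.stmts_trans ?_ hq
      rw [TM2.stmts₁]
      cases f v <;> simp [TM2.stmts₁_self]
    | goto f => cases h; exact hM _
    | halt => cases h; exact hN
    | _ =>
      cases h
      refine TM2.stmts_trans ?_ hq
      rw [TM2.stmts₁]
      simp [TM2.stmts₁_self]

end

variable [DecidableEq K]

/-- The new symbols at some depth after a small step, from the old ones in the neighbourhood. -/
def cellUpd : Control Γ Λ σ → Option (Column Γ) → Column Γ → Column Γ → Column Γ
  | (some (.push k f _), v), l, m, _ =>
    Function.update m k (match l with | none => some (f v) | some l => l k)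
  | (some (.pop k _ _), _), _, m, r => Function.update m k (r k)
  | _, _, m, _ => m

/-- The new stacks after a small step. -/
def stackUpd : Control Γ Λ σ → Stacks Γ → Stacks Γ
  | (some (.push k f _), v), S => Function.update S k (f v :: S k)
  | (some (.pop k _ _), _), S => Function.update S k (S k).tail
  | _, S => S

/-- This is the locality that makes tilings applicable: a push or pop shifts one stack by one place,
and other small steps leave the stacks alone. -/
theorem col_stackUpd (q : Control Γ Λ σ) (S : Stacks Γ) (i : ℕ) :
    col (stackUpd q S) i = cellUpd q (leftCol S i) (col S i) (col S (i + 1)) := by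
  obtain ⟨s | s, v⟩ := q
  · rfl
  cases s with
  | push k f s =>
    ext1 k'
    by_cases h : k' = k
    · subst h
      cases i <;> simp [col, stackUpd, cellUpd, leftCol]
    · simp [col, stackUpd, cellUpd, h]
  | pop k f s =>
    ext1 k'
    by_cases h : k' = k
    · subst h
      simp [col, stackUpd, cellUpd]
    · simp [col, stackUpd, cellUpd, h]
  | _ => rfl

variable (M : Λ → TM2.Stmt Γ Λ σ) (ok : Column Γ → Prop)

/-- A small step. -/
noncomputable def mstep (c : Control Γ Λ σ × Stacks Γ) : Option (Control Γ Λ σ × Stacks Γ) :=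
  (ctrl M ok c.1 (col c.2 0)).map fun q => (q, stackUpd c.1 c.2)

/-- The small-step configuration at the beginning of a step. -/
def ofCfg (c : TM2.Cfg Γ Λ σ) : Control Γ Λ σ × Stacks Γ := ((c.l.map M, c.var), c.stk)

/-- A bound for the number of small steps in a statement. -/
def stmtSize : TM2.Stmt Γ Λ σ → ℕ
  | .push _ _ s => stmtSize s + 1
  | .peek _ _ s => stmtSize s + 1
  | .pop _ _ s => stmtSize s + 1
  | .load _ s => stmtSize s + 1
  | .branch _ s s' => max (stmtSize s) (stmtSize s') + 1
  | .goto _ => 1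
  | .halt => 1

theorem iter_mstep_of_mstep {c c' d : Control Γ Λ σ × Stacks Γ} {n : ℕ}
    (h : mstep M ok c = some c') (h' : ∃ j ≤ n, iter (mstep M ok) j c' = some d) :
    ∃ j ≤ n + 1, iter (mstep M ok) j c = some d := by
  obtain ⟨j, hj, h'⟩ := h'
  refine ⟨1 + j, by omega, ?_⟩
  rw [iter_add (by rwa [iter_one]), h']

theorem iter_mstep_stepAux (s : TM2.Stmt Γ Λ σ) (v : σ) (S : Stacks Γ) :
    ∃ j ≤ stmtSize s,
      iter (mstep M ok) j ((some s, v), S) = some (ofCfg M (TM2.stepAux s v S)) := by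
  induction s generalizing v S with
  | push k f s ih => exact iter_mstep_of_mstep M ok rfl (ih _ _)
  | peek k f s ih =>
    rw [TM2.stepAux, head?_eq_col]
    exact iter_mstep_of_mstep M ok rfl (ih _ _)
  | pop k f s ih =>
    rw [TM2.stepAux, head?_eq_col]
    exact iter_mstep_of_mstep M ok rfl (ih _ _)
  | load f s ih => exact iter_mstep_of_mstep M ok rfl (ih _ _)
  | branch f s s' ih ih' =>
    rw [TM2.stepAux]
    refine iter_mstep_of_mstep M ok rfl ?_
    cases f v
    · obtain ⟨j, hj, h⟩ := ih' v S
      exact ⟨j, by omega, h⟩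
    · obtain ⟨j, hj, h⟩ := ih v S
      exact ⟨j, by omega, h⟩
  | goto f => exact ⟨1, le_rfl, by rw [iter_one]; rfl⟩
  | halt => exact ⟨1, le_rfl, by rw [iter_one]; rfl⟩

theorem exists_iter_mstep [Fintype Λ] : ∃ C, ∀ n c c', iter (TM2.step M) n c = some c' →
    ∃ j ≤ C * n, iter (mstep M ok) j (ofCfg M c) = some (ofCfg M c') := by
  -- The sum over all labels bounds the small steps needed for the statement at any one label.
  refine ⟨∑ l, stmtSize (M l), fun n c c' h => ?_⟩
  induction n generalizing c' with
  | zero =>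
    rw [iter_zero, Option.some.injEq] at h
    subst h
    exact ⟨0, le_rfl, rfl⟩
  | succ n ih =>
    rw [iter_succ] at h
    obtain ⟨d, hd, h⟩ := Option.bind_eq_some_iff.1 h
    obtain ⟨j, hj, e⟩ := ih d hd
    obtain ⟨_ | l, v, S⟩ := d
    · simp at h
    · rw [TM2.step, Option.some.injEq] at h
      subst h
      obtain ⟨j', hj', e'⟩ := iter_mstep_stepAux M ok (M l) v S
      refine ⟨j + j', ?_, ?_⟩
      · have := Finset.single_le_sum (f := fun l => stmtSize (M l)) (fun _ _ => Nat.zero_le _)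
          (Finset.mem_univ l)
        rw [Nat.mul_succ]
        exact Nat.add_le_add hj (hj'.trans this)
      · rw [iter_add e]
        exact e'

/-! ### The tiles for a machine -/

variable [Fintype Λ]

variable {k₀ : K}

/-- The column with the symbol `o` on the stack `k₀` and nothing on the other stacks. -/
def single (o : Option (Γ k₀)) : Column Γ := Function.update (fun _ => none) k₀ o

/-- The tiling system for a machine that starts at the statement `M l₀` with the internal state
`v₀`, where `e` writes the input and the certificate on the stack `k₀`. -/
def tiling (l₀ : Λ) (v₀ : σ) (e : Bool ⊕ Bool → Γ k₀) : TilingSystem (Tile M) where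
  hor d d' := d.control = d'.control ∧ d'.left = some d.mid ∧ d.right = d'.mid ∧
    ∀ k, d.mid k = none → d'.mid k = none
  ver d d' := d'.mid = cellUpd d.control d.left d.mid d.right ∧
    (d.left = none → d'.left = none ∧ ctrl M ok d.control d.mid = some d'.control)
  symb b d := d.mid = single (some (e (.inl b)))
  cert d := d.mid = single (k₀ := k₀) none ∨ ∃ b, d.mid = single (some (e (.inr b)))
  blank d := d.mid = single (k₀ := k₀) none
  left d := d.left = none ∧ d.control = (some (M l₀), v₀)

/-- The initial stacks for the input `x` and the certificate `y`. -/
def initStacks (e : Bool ⊕ Bool → Γ k₀) (x y : List Bool) : Stacks Γ :=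
  Function.update (fun _ => []) k₀ ((x.map Sum.inl ++ y.map Sum.inr).map e)

theorem col_initStacks (e : Bool ⊕ Bool → Γ k₀) (x y : List Bool) (i : ℕ) :
    col (initStacks e x y) i = single ((x.map Sum.inl ++ y.map Sum.inr)[i]?.map e) := by
  ext1 k
  by_cases h : k = k₀
  · subst h
    simp only [col, initStacks, single, Function.update_self, List.getElem?_map]
  · simp [col, initStacks, single, h]

theorem single_none : single (none : Option (Γ k₀)) = fun _ => none := by
  simp [single]

theorem eq_single_none_of_le {g : ℕ → Column Γ} {a N : ℕ}
    (hp : ∀ j, j + 1 < N → ∀ k, g j k = none → g (j + 1) k = none)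
    (h : g a = single (none : Option (Γ k₀))) (j : ℕ) (hj : a + j < N) :
    g (a + j) = single (none : Option (Γ k₀)) := by
  rw [single_none] at h ⊢
  induction j with
  | zero => exact h
  | succ j ih =>
    ext1 k
    exact hp (a + j) hj k (congrFun (ih (by omega)) k)

/-- Emptiness of a stack propagates to greater depths, so the certificate is read off up to the
first empty place, which occurs after at most `P` symbols by `hb`. Without the propagation, gaps
would be possible. -/
theorem exists_certificate (e : Bool ⊕ Bool → Γ k₀) {g : ℕ → Column Γ} {P N : ℕ} (hP : P < N)
    (hp : ∀ j, j + 1 < N → ∀ k, g j k = none → g (j + 1) k = none)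
    (hc : ∀ j < P, g j = single (k₀ := k₀) none ∨ ∃ b, g j = single (some (e (.inr b))))
    (hb : g P = single (k₀ := k₀) none) :
    ∃ y : List Bool, y.length ≤ P ∧
      ∀ j < N, g j = single ((y.map Sum.inr)[j]?.map e) := by
  have hz : g 0 = single (k₀ := k₀) none → ∃ y : List Bool, y.length ≤ P ∧
      ∀ j < N, g j = single ((y.map Sum.inr)[j]?.map e) := fun h =>
    ⟨[], by simp, fun j hj => by
      have := eq_single_none_of_le hp h j (by omega)
      rw [zero_add] at this
      rw [this]; simp⟩
  induction P generalizing g N with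
  | zero => exact hz hb
  | succ P ih =>
    rcases hc 0 (by omega) with h | ⟨b, h⟩
    · exact hz h
    · obtain ⟨y, hy, hg⟩ := ih (g := fun j => g (j + 1)) (N := N - 1) (by omega)
        (fun j hj => hp (j + 1) (by omega)) (fun j hj => hc (j + 1) (by omega)) hb
        (fun h' => ⟨[], by simp, fun j hj => by
          have := eq_single_none_of_le hp h' j (by omega)
          rw [add_comm] at this
          rw [this]; simp⟩)
      refine ⟨b :: y, by simpa using hy, fun j hj => ?_⟩
      cases j with
      | zero => simpa using h
      | succ j => simpa using hg j (by omega)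

variable {M ok}

theorem exists_run {l₀ : Λ} {v₀ : σ} {e : Bool ⊕ Bool → Γ k₀} {x : List Bool} {P T : ℕ}
    (hT : x.length + P < T) {τ : ℕ → ℕ → Tile M}
    (h₀ : (tiling M ok l₀ v₀ e).Starts x P (τ 0))
    (hh : ∀ t i, t < T → i + 1 < T → (tiling M ok l₀ v₀ e).hor (τ t i) (τ t (i + 1)))
    (hv : ∀ t i, t + 1 < T → i < T → (tiling M ok l₀ v₀ e).ver (τ t i) (τ (t + 1) i)) :
    ∃ y : List Bool, y.length ≤ P ∧
      ∀ t < T, iter (mstep M ok) t ((some (M l₀), v₀), initStacks e x y) ≠ none := by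
  obtain ⟨y, hy, hrow⟩ : ∃ y : List Bool, y.length ≤ P ∧
      ∀ i < T, (τ 0 i).mid = col (initStacks e x y) i := by
    obtain ⟨y, hy, hg⟩ := exists_certificate e (g := fun j => (τ 0 (x.length + j)).mid)
      (P := P) (N := T - x.length) (by omega)
      (fun j hj => (hh 0 (x.length + j) (by omega) (by omega)).2.2.2) h₀.cert h₀.blank
    refine ⟨y, hy, fun i hi => ?_⟩
    rw [col_initStacks]
    rcases Nat.lt_or_ge i x.length with h | h
    · rw [h₀.symb i h, List.getElem?_append_left (by simpa using h)]
      simp [h]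
    · obtain ⟨j, rfl⟩ := Nat.exists_eq_add_of_le h
      rw [hg j (by omega), List.getElem?_append_right (by simp)]
      simp
  refine ⟨y, hy, fun t ht => ?_⟩
  -- The symbols at depth `i` after a step depend on depth `i + 1` before it, so one more place at
  -- the right border is lost in each row. Row `t` is controlled only on the triangle `i + t < T`,
  -- which still contains the place `0` where the control is computed.
  have key : ∀ t < T, ∃ q S, iter (mstep M ok) t ((some (M l₀), v₀), initStacks e x y) = some (q, S) ∧
      ∀ i, i + t < T → (τ t i).mid = col S i ∧ (τ t i).left = leftCol S i ∧ (τ t i).control = q := by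
    intro t
    induction t with
    | zero =>
      intro _
      refine ⟨_, _, iter_zero _ _, fun i hi => ⟨hrow i (by omega), ?_, ?_⟩⟩
      · cases i with
        | zero => exact h₀.left.1
        | succ i => rw [(hh 0 i (by omega) (by omega)).2.1, hrow i (by omega)]; rfl
      · induction i with
        | zero => exact h₀.left.2
        | succ i ih => rw [← (hh 0 i (by omega) (by omega)).1, ih (by omega)]
    | succ t ih =>
      intro ht
      obtain ⟨q, S, hrun, hrow⟩ := ih (by omega)
      obtain ⟨hm0, hl0, hq0⟩ := hrow 0 (by omega)
      obtain ⟨-, hv0⟩ := hv t 0 ht (by omega)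
      obtain ⟨hleft, hctrl⟩ := hv0 hl0
      rw [hm0, hq0] at hctrl
      have hmid : ∀ i, i + (t + 1) < T → (τ (t + 1) i).mid = col (stackUpd q S) i := by
        intro i hi
        obtain ⟨hm, hl, hq⟩ := hrow i (by omega)
        rw [(hv t i ht (by omega)).1, hm, hl, hq, (hh t i (by omega) (by omega)).2.2.1,
          (hrow (i + 1) (by omega)).1, col_stackUpd]
      refine ⟨(τ (t + 1) 0).control, stackUpd q S, ?_, fun i hi => ⟨hmid i hi, ?_, ?_⟩⟩
      · rw [iter_succ, hrun, Option.bind_some, mstep, hctrl]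
        rfl
      · cases i with
        | zero => exact hleft
        | succ i => rw [(hh (t + 1) i ht (by omega)).2.1, hmid i (by omega)]; rfl
      · induction i with
        | zero => rfl
        | succ i ih => rw [← (hh (t + 1) i ht (by omega)).1, ih (by omega)]
  obtain ⟨q, S, h, -⟩ := key t ht
  rw [h]
  simp

/-- The tiles are read off the run. The rule on empty symbols holds because a list without an entry
at index `i` has none at `i + 1`. -/
theorem exists_tiling_of_run {l₀ : Λ} {v₀ : σ} {e : Bool ⊕ Bool → Γ k₀} {x y : List Bool} {P : ℕ}
    (hy : y.length ≤ P)
    (hrun : ∀ t, iter (mstep M ok) t ((some (M l₀), v₀), initStacks e x y) ≠ none) :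
    ∃ τ : ℕ → ℕ → Tile M, (tiling M ok l₀ v₀ e).Starts x P (τ 0) ∧
      (∀ t i, (tiling M ok l₀ v₀ e).hor (τ t i) (τ t (i + 1))) ∧
      ∀ t i, (tiling M ok l₀ v₀ e).ver (τ t i) (τ (t + 1) i) := by
  choose c hc using fun t => Option.ne_none_iff_exists'.1 (hrun t)
  have hstep : ∀ t, ctrl M ok (c t).1 (col (c t).2 0) = some (c (t + 1)).1 ∧
      stackUpd (c t).1 (c t).2 = (c (t + 1)).2 := by
    intro t
    have := hc (t + 1)
    rw [iter_succ, hc t, Option.bind_some, mstep, Option.map_eq_some_iff] at this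
    obtain ⟨q, hq, h⟩ := this
    rw [← h]
    exact ⟨hq, rfl⟩
  have hmem : ∀ t, (c t).1.1 ∈ TM2.stmts M Finset.univ := by
    intro t
    induction t with
    | zero =>
      have := hc 0
      rw [iter_zero, Option.some.injEq] at this
      rw [← this]
      simp only [TM2.stmts, Finset.some_mem_insertNone, Finset.mem_biUnion]
      exact ⟨l₀, Finset.mem_univ _, TM2.stmts₁_self⟩
    | succ t ih => exact ctrl_mem_stmts (hstep t).1 ih
  have h0 : c 0 = ((some (M l₀), v₀), initStacks e x y) := by
    have := hc 0
    rw [iter_zero, Option.some.injEq] at this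
    exact this.symm
  refine ⟨fun t i => ⟨leftCol (c t).2 i, col (c t).2 i, col (c t).2 (i + 1), ⟨_, hmem t⟩, (c t).1.2⟩,
    ⟨fun i hi => ?_, fun j hj => ?_, ?_, ?_⟩, fun t i => ⟨rfl, rfl, rfl, fun k hk => ?_⟩,
    fun t i => ⟨?_, fun hl => ?_⟩⟩
  · change col (c 0).2 i = _
    rw [h0, col_initStacks, List.getElem?_append_left (by simpa using hi)]
    simp [hi]
  · change col (c 0).2 _ = _ ∨ ∃ b, col (c 0).2 _ = _
    rw [h0, col_initStacks, List.getElem?_append_right (by simp)]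
    simp only [List.length_map, Nat.add_sub_cancel_left, List.getElem?_map]
    cases y[j]? with
    | none => exact Or.inl rfl
    | some b => exact Or.inr ⟨b, rfl⟩
  · change col (c 0).2 _ = _
    rw [h0, col_initStacks, List.getElem?_eq_none (by simpa using hy)]
    rfl
  · refine ⟨rfl, ?_⟩
    change (c 0).1 = _
    rw [h0]
  · simp only [col, List.getElem?_eq_none_iff] at hk ⊢
    omega
  · change col (c (t + 1)).2 i = _
    rw [← (hstep t).2, col_stackUpd]
    rfl
  · cases i with
    | zero => exact ⟨rfl, (hstep t).1⟩
    | succ i => cases hl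

end Micro

end SatVariant

/-! ### Structured programs compiled to stack machines. -/

namespace SatVariant

open Turing

/-! ### A structured programming language for machines with stacks -/

/-- Programs that work on stacks with the alphabets `Γ k`: `loop k p` pops a symbol from the stack
`k` and executes `p` for this symbol, until the stack is empty. -/
inductive Prog {K : Type} (Γ : K → Type) : Type
  | skip : Prog Γ
  | push : ∀ k, Γ k → Prog Γ
  | seq : Prog Γ → Prog Γ → Prog Γ
  | loop : ∀ k, (Γ k → Prog Γ) → Prog Γ

namespace Prog

variable {K : Type} {Γ : K → Type}

/-- The places in a program. -/
def Label : Prog Γ → Type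
  | skip => Unit
  | push _ _ => Unit
  | seq p q => Label p ⊕ Label q
  | loop _ p => Option (Σ a, Label (p a))

/-- The place where a program starts. -/
def entry : (p : Prog Γ) → Label p
  | skip => ()
  | push _ _ => ()
  | seq p _ => Sum.inl (entry p)
  | loop _ _ => none

theorem finite_label [∀ k, Finite (Γ k)] : (p : Prog Γ) → Finite (Label p)
  | skip => inferInstanceAs (Finite Unit)
  | push _ _ => inferInstanceAs (Finite Unit)
  | seq p q =>
    have := finite_label p
    have := finite_label q
    inferInstanceAs (Finite (Label p ⊕ Label q))
  | loop _ p =>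
    have := fun a => finite_label (p a)
    inferInstanceAs (Finite (Option (Σ a, Label (p a))))

variable [DecidableEq K]

/-- The statements for the places of a program that is part of a larger one, with places `Λ`, and
that is followed by the place `exit`. -/
def code {Λ : Type} : (p : Prog Γ) → (Label p → Λ) → Λ → Label p →
    TM2.Stmt Γ Λ (∀ k, Option (Γ k))
  | skip, _, exit, _ => .goto fun _ => exit
  | push k a, _, exit, _ => .push k (fun _ => a) (.goto fun _ => exit)
  | seq p q, emb, _, .inl l => code p (fun l => emb (.inl l)) (emb (.inr (entry q))) l
  | seq _ q, emb, exit, .inr l => code q (fun l => emb (.inr l)) exit l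
  | loop k p, emb, exit, none =>
    .pop k (fun v o => Function.update v k o) (.goto fun v =>
      match v k with
      | some a => emb (some ⟨a, entry (p a)⟩)
      | none => exit)
  | loop _ p, emb, _, some ⟨a, l⟩ => code (p a) (fun l => emb (some ⟨a, l⟩)) (emb none) l

/-- The program `p` transforms the stacks `S` to `S'` in `n` steps. -/
inductive Run : Prog Γ → (∀ k, List (Γ k)) → (∀ k, List (Γ k)) → ℕ → Prop
  | skip (S) : Run .skip S S 1
  | push (k a S) : Run (.push k a) S (Function.update S k (a :: S k)) 1
  | seq {p q S S' S'' m n} : Run p S S' m → Run q S' S'' n → Run (.seq p q) S S'' (m + n)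
  | loop_nil {k p} {S : ∀ k, List (Γ k)} (h : S k = []) : Run (.loop k p) S S 1
  | loop_cons {k p a l m n} {S S' S'' : ∀ k, List (Γ k)} (h : S k = a :: l) :
    Run (p a) (Function.update S k l) S' m → Run (.loop k p) S' S'' n →
      Run (.loop k p) S S'' (1 + (m + n))

/-- The surrounding machine, the embedding of the labels and the exit are arbitrary, so that the
induction passes to subprograms. So is the internal state: a loop stores the popped symbol just
before it branches on it, so older values never matter. -/
theorem Run.iter_step {p : Prog Γ} {S S' : ∀ k, List (Γ k)} {n : ℕ} (h : Run p S S' n) {Λ : Type}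
    (M : Λ → TM2.Stmt Γ Λ (∀ k, Option (Γ k))) (emb : Label p → Λ) (exit : Λ)
    (hM : ∀ l, M (emb l) = code p emb exit l) (v : ∀ k, Option (Γ k)) :
    ∃ v', iter (TM2.step M) n ⟨some (emb (entry p)), v, S⟩ = some ⟨some exit, v', S'⟩ := by
  induction h generalizing Λ v with
  | skip S => exact ⟨v, by rw [iter_one, TM2.step, hM]; rfl⟩
  | push k a S => exact ⟨v, by rw [iter_one, TM2.step, hM]; rfl⟩
  | @seq p q S S' S'' m n _ _ ih ih' =>
    obtain ⟨v', h⟩ := ih M (fun l => emb (.inl l)) (emb (.inr (entry q))) (fun l => hM _) v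
    obtain ⟨v'', h'⟩ := ih' M (fun l => emb (.inr l)) exit (fun l => hM _) v'
    exact ⟨v'', by rw [← h', ← iter_add h]; rfl⟩
  | @loop_nil k p S h =>
    refine ⟨Function.update v k none, ?_⟩
    rw [iter_one, TM2.step, hM, entry, code]
    simp [h]
  | @loop_cons k p a l m n S S' S'' h _ _ ih ih' =>
    obtain ⟨v', h₁⟩ := ih M (fun l => emb (some ⟨a, l⟩)) (emb none) (fun l => hM _)
      (Function.update v k (some a))
    obtain ⟨v'', h₂⟩ := ih' M emb exit hM v'
    refine ⟨v'', ?_⟩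
    rw [← h₂, iter_add (d := ⟨some (emb (some ⟨a, entry (p a)⟩)), Function.update v k (some a),
      Function.update S k l⟩), iter_add h₁]
    · rfl
    · rw [iter_one, TM2.step, hM, entry, code]
      simp [h]

/-- The machine for a program. -/
noncomputable def machine [Fintype K] [∀ k, Fintype (Γ k)] (p : Prog Γ) (k₀ k₁ : K) : FinTM2 where
  K := K
  k₀ := k₀
  k₁ := k₁
  Γ := Γ
  Λ := Option (Label p)
  main := some (entry p)
  ΛFin := by
    have := finite_label p
    exact Fintype.ofFinite _
  σ := ∀ k, Option (Γ k)
  initialState := fun _ => none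
  m
    | some l => code p some none l
    | none => .load (fun _ _ => none) .halt

theorem initList_eq (M : FinTM2) (s : List (M.Γ M.k₀)) :
    initList M s = ⟨some M.main, M.initialState, Function.update (fun _ => []) M.k₀ s⟩ := by
  unfold initList
  congr 1
  ext1 k
  by_cases h : k = M.k₀
  · subst h; simp
  · simp [h]

theorem haltList_eq (M : FinTM2) (s : List (M.Γ M.k₁)) :
    haltList M s = ⟨none, M.initialState, Function.update (fun _ => []) M.k₁ s⟩ := by
  unfold haltList
  congr 1
  ext1 k
  by_cases h : k = M.k₁
  · subst h; simp
  · simp [h]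

/-- A function is computable in polynomial time if there is a program for it that takes polynomially
many steps. -/
theorem polyTimeComputable [Fintype K] [∀ k, Fintype (Γ k)] {α β A B : Type}
    {ea : Computability.Encoding α A} {eb : Computability.Encoding β B} {f : α → β}
    (p : Prog Γ) (k₀ k₁ : K) (e₀ : Γ k₀ ≃ A) (e₁ : Γ k₁ ≃ B) (time : Polynomial ℕ)
    (h : ∀ a, ∃ n ≤ time.eval (ea.encode a).length,
      Run p (Function.update (fun _ => []) k₀ ((ea.encode a).map e₀.symm))
        (Function.update (fun _ => []) k₁ ((eb.encode (f a)).map e₁.symm)) n) :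
    PolyTimeComputable ea eb f := by
  choose n hn hrun using h
  -- The additional step restores the initial internal state, which the prescribed final
  -- configuration requires, and halts.
  refine ⟨{ tm := machine p k₀ k₁, inputAlphabet := e₀, outputAlphabet := e₁, time := time + 1,
            outputsFun := fun a => ⟨⟨n a + 1, ?_⟩, ?_⟩ }, fun k => ?_⟩
  · have := (hrun a).iter_step (machine p k₀ k₁).m some none (fun l => rfl) (fun _ => none)
    obtain ⟨v', h⟩ := this
    rw [initList_eq, Option.map_some, haltList_eq]
    refine (iter_succ _ _ _).trans ?_
    refine (congrArg (fun o => Option.bind o _) h).trans ?_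
    rfl
  · simpa using hn a
  · exact (fun k => inferInstance : ∀ k, Finite (Γ k)) k

end Prog
end SatVariant

/-! ### Counter programs for arithmetic and for printing texts. -/

namespace SatVariant

/-! ### States of the program for the reduction -/

/-- The counters of the program: the length of the input and later the present place in row `0`, the
number of places for the certificate, the numbers of rows and columns that remain, the present row
and column, and two auxiliary ones. -/
inductive Counter
  | pos | certs | rows | columns | row | column | aux | aux'
  deriving DecidableEq

instance : Fintype Counter where
  elems := {.pos, .certs, .rows, .columns, .row, .column, .aux, .aux'}
  complete c := by cases c <;> decide

/-- The stacks of the program. -/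
inductive StackName
  | inp | tmp | out | ctr (c : Counter)
  deriving DecidableEq, Fintype

/-- The alphabets of the stacks. -/
def Alphabet : StackName → Type
  | .inp => Bool
  | .tmp => FormulaSymbol
  | .out => FormulaSymbol
  | .ctr _ => Unit

instance : ∀ k, Fintype (Alphabet k)
  | .inp => inferInstanceAs (Fintype Bool)
  | .tmp => inferInstanceAs (Fintype FormulaSymbol)
  | .out => inferInstanceAs (Fintype FormulaSymbol)
  | .ctr _ => inferInstanceAs (Fintype Unit)

/-- The contents of the stacks. -/
@[ext]
structure State where
  inp : List Bool
  tmp : List FormulaSymbol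
  out : List FormulaSymbol
  cnt : Counter → ℕ

namespace State

/-- The contents of the stacks as a function. -/
def contents (s : State) : ∀ k, List (Alphabet k)
  | .inp => s.inp
  | .tmp => s.tmp
  | .out => s.out
  | .ctr c => List.replicate (s.cnt c) ()

/-- The state with the value `v` of the counter `c`. -/
def set (s : State) (c : Counter) (v : ℕ) : State := { s with cnt := Function.update s.cnt c v }

/-- The state after writing `w` on the temporary stack. -/
def emit (s : State) (w : List FormulaSymbol) : State := { s with tmp := w.reverse ++ s.tmp }

@[simp] theorem set_inp (s : State) (c : Counter) (v : ℕ) : (s.set c v).inp = s.inp := rfl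
@[simp] theorem set_tmp (s : State) (c : Counter) (v : ℕ) : (s.set c v).tmp = s.tmp := rfl
@[simp] theorem set_out (s : State) (c : Counter) (v : ℕ) : (s.set c v).out = s.out := rfl
@[simp] theorem set_cnt (s : State) (c d : Counter) (v : ℕ) :
    (s.set c v).cnt d = if d = c then v else s.cnt d := by
  simp [set, Function.update_apply]
@[simp] theorem emit_inp (s : State) (w : List FormulaSymbol) : (s.emit w).inp = s.inp := rfl
@[simp] theorem emit_tmp (s : State) (w : List FormulaSymbol) :
    (s.emit w).tmp = w.reverse ++ s.tmp := rfl
@[simp] theorem emit_out (s : State) (w : List FormulaSymbol) : (s.emit w).out = s.out := rfl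
@[simp] theorem emit_cnt (s : State) (w : List FormulaSymbol) : (s.emit w).cnt = s.cnt := rfl

theorem emit_emit (s : State) (w w' : List FormulaSymbol) :
    (s.emit w).emit w' = s.emit (w ++ w') := by
  simp [emit]

theorem contents_set (s : State) (c : Counter) (v : ℕ) :
    (s.set c v).contents = Function.update s.contents (.ctr c) (List.replicate v ()) := by
  ext1 k
  cases k with
  | ctr d =>
    by_cases h : d = c
    · subst h
      rw [Function.update_self, contents, set_cnt, if_pos rfl]
    · rw [Function.update_of_ne (by simpa using h), contents, set_cnt, if_neg h]
      rfl
  | _ => exact (Function.update_of_ne (by simp) ..).symm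

theorem contents_tmp (s : State) (l : List FormulaSymbol) :
    ({ s with tmp := l } : State).contents = Function.update s.contents .tmp l := by
  ext1 k
  cases k with
  | tmp => exact (Function.update_self (StackName.tmp) l s.contents).symm
  | _ =>
    exact (Function.update_of_ne (β := fun k => List (Alphabet k)) (a' := .tmp) (by simp) l _).symm

theorem contents_out (s : State) (l : List FormulaSymbol) :
    ({ s with out := l } : State).contents = Function.update s.contents .out l := by
  ext1 k
  cases k with
  | out => exact (Function.update_self (StackName.out) l s.contents).symm
  | _ =>
    exact (Function.update_of_ne (β := fun k => List (Alphabet k)) (a' := .out) (by simp) l _).symm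

theorem contents_inp (s : State) (l : List Bool) :
    ({ s with inp := l } : State).contents = Function.update s.contents .inp l := by
  ext1 k
  cases k with
  | inp => exact (Function.update_self (StackName.inp) l s.contents).symm
  | _ =>
    exact (Function.update_of_ne (β := fun k => List (Alphabet k)) (a' := .inp) (by simp) l _).symm

end State

/-- The program `p` transforms the state `s` to `s'` in at most `t` steps. -/
def Runs (p : Prog Alphabet) (s s' : State) (t : ℕ) : Prop :=
  ∃ n ≤ t, p.Run s.contents s'.contents n

namespace Runs

theorem mono {p : Prog Alphabet} {s s' : State} {t t' : ℕ} (h : Runs p s s' t) (ht : t ≤ t') :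
    Runs p s s' t' :=
  let ⟨n, hn, h⟩ := h
  ⟨n, hn.trans ht, h⟩

theorem of_eq {p : Prog Alphabet} {s s' r r' : State} {t t' : ℕ} (h : Runs p s s' t)
    (hr : r = s) (hr' : r' = s') (ht : t ≤ t') : Runs p r r' t' := by
  subst hr hr'
  exact h.mono ht

theorem skip (s : State) : Runs .skip s s 1 := ⟨1, le_rfl, .skip _⟩

theorem seq {p q : Prog Alphabet} {s s' s'' : State} {t t' : ℕ} (h : Runs p s s' t)
    (h' : Runs q s' s'' t') : Runs (.seq p q) s s'' (t + t') :=
  let ⟨n, hn, h⟩ := h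
  let ⟨n', hn', h'⟩ := h'
  ⟨n + n', Nat.add_le_add hn hn', .seq h h'⟩

theorem push (s : State) (c : Counter) :
    Runs (.push (.ctr c) ()) s (s.set c (s.cnt c + 1)) 1 := by
  refine ⟨1, le_rfl, ?_⟩
  rw [State.contents_set]
  exact .push _ _ _

theorem emit (s : State) (a : FormulaSymbol) : Runs (.push .tmp a) s (s.emit [a]) 1 := by
  refine ⟨1, le_rfl, ?_⟩
  have : (s.emit [a]).contents = Function.update s.contents .tmp (a :: s.tmp) :=
    State.contents_tmp _ _
  rw [this]
  exact .push _ _ _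

/-- `I j` is the state after `j` passes, before the next symbol is popped. Each pass costs one pop
and the body, and the `+ 1` is the final pop from the empty stack. -/
theorem loop {c : Counter} {b : Unit → Prog Alphabet} {m t : ℕ} (I : ℕ → State)
    (hc : ∀ j, (I j).cnt c = m - j)
    (hb : ∀ j < m, Runs (b ()) ((I j).set c (m - j - 1)) (I (j + 1)) t) :
    Runs (.loop (.ctr c) b) (I 0) (I m) (m * (t + 1) + 1) := by
  induction m generalizing I with
  | zero =>
    refine ⟨1, by omega, .loop_nil ?_⟩
    simp [State.contents, hc]
  | succ m ih =>
    obtain ⟨n, hn, h⟩ := hb 0 (by omega)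
    obtain ⟨n', hn', h'⟩ := ih (fun j => I (j + 1)) (fun j => by rw [hc]; omega)
      (fun j hj => by
        have := hb (j + 1) (by omega)
        rwa [show m + 1 - (j + 1) - 1 = m - j - 1 by omega] at this)
    refine ⟨1 + (n + n'), by rw [Nat.succ_mul]; omega, ?_⟩
    refine Prog.Run.loop_cons (a := ()) (l := List.replicate m ()) ?_ ?_ h'
    · rw [State.contents, hc]
      rfl
    · rw [State.contents_set] at h
      exact h

theorem loop_inp {b : Bool → Prog Alphabet} {x : List Bool} {t : ℕ} (I : ℕ → State)
    (hx : ∀ j, (I j).inp = x.drop j)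
    (hb : ∀ j, ∀ h : j < x.length,
      Runs (b x[j]) { I j with inp := x.drop (j + 1) } (I (j + 1)) t) :
    Runs (.loop .inp b) (I 0) (I x.length) (x.length * (t + 1) + 1) := by
  induction x generalizing I with
  | nil =>
    refine ⟨1, by simp, .loop_nil ?_⟩
    exact hx 0
  | cons a x ih =>
    obtain ⟨n, hn, h⟩ := hb 0 (by simp)
    obtain ⟨n', hn', h'⟩ := ih (fun j => I (j + 1)) (fun j => hx (j + 1))
      (fun j hj => hb (j + 1) (by simpa using hj))
    refine ⟨1 + (n + n'), by rw [List.length_cons, Nat.succ_mul]; omega, ?_⟩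
    refine Prog.Run.loop_cons (a := a) (l := x) ?_ ?_ h'
    · exact hx 0
    · rw [State.contents_inp] at h
      exact h

theorem reverse (s : State) :
    Runs (.loop .tmp fun a => .push .out a) s { s with tmp := [], out := s.tmp.reverse ++ s.out }
      (s.tmp.length * 2 + 1) := by
  obtain ⟨inp, tmp, out, cnt⟩ := s
  induction tmp generalizing out with
  | nil => exact ⟨1, by simp, .loop_nil rfl⟩
  | cons a l ih =>
    obtain ⟨n, hn, h⟩ := ih (a :: out)
    refine ⟨1 + (1 + n), by simp only [List.length_cons] at hn ⊢; omega, ?_⟩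
    refine Prog.Run.loop_cons (a := a) (l := l) rfl ?_ (by simpa using h)
    have := Prog.Run.push (Γ := Alphabet) .out a (State.contents ⟨inp, l, out, cnt⟩)
    have e := State.contents_tmp ⟨inp, a :: l, out, cnt⟩ l
    have e' := State.contents_out ⟨inp, l, out, cnt⟩ (a :: out)
    simp only at e e'
    rw [← e, e']
    exact this

end Runs

/-- A step pushes at most one symbol. This later bounds the length of the printed text by the time
spent on it. -/
theorem Prog.Run.length_le {K : Type} {Γ : K → Type} [DecidableEq K] {p : Prog Γ}
    {S S' : ∀ k, List (Γ k)} {n : ℕ} (h : p.Run S S' n) (k : K) :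
    (S' k).length ≤ (S k).length + n := by
  induction h with
  | skip S => omega
  | push k' a S =>
    by_cases h : k = k'
    · subst h; simp
    · simp [h]
  | seq _ _ ih ih' => omega
  | loop_nil h => omega
  | @loop_cons k' p a l m n S S' S'' h _ _ ih ih' =>
    have : (Function.update S k' l k).length ≤ (S k).length := by
      by_cases e : k = k'
      · subst e; simp [h]
      · simp [e]
    omega

/-! ### Arithmetic with counters -/

open Counter

/-- Increase the counter `y` by `k`. -/
def bump (y : Counter) : ℕ → Prog Alphabet
  | 0 => .skip
  | k + 1 => .seq (bump y k) (.push (.ctr y) ())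

theorem runs_bump (y : Counter) (k : ℕ) (s : State) :
    Runs (bump y k) s (s.set y (s.cnt y + k)) (k + 1) := by
  induction k with
  | zero =>
    exact (Runs.skip s).of_eq rfl (State.ext rfl rfl rfl (funext fun d => by grind [State.set_cnt, State.emit_cnt])) le_rfl
  | succ k ih =>
    exact (ih.seq (Runs.push _ y)).of_eq rfl
      (State.ext rfl rfl rfl (funext fun d => by grind [State.set_cnt, State.emit_cnt])) le_rfl

/-- Set the counter `y` to zero. -/
def clear (y : Counter) : Prog Alphabet := .loop (.ctr y) fun _ => .skip

theorem runs_clear (y : Counter) (s : State) :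
    Runs (clear y) s (s.set y 0) (s.cnt y * 2 + 1) := by
  have := Runs.loop (c := y) (b := fun _ => .skip) (m := s.cnt y) (t := 1)
    (fun j => s.set y (s.cnt y - j)) (by simp) (fun j _ => (Runs.skip _).of_eq rfl
      (State.ext rfl rfl rfl (funext fun d => by grind [State.set_cnt, State.emit_cnt])) le_rfl)
  exact this.of_eq (State.ext rfl rfl rfl (funext fun d => by grind [State.set_cnt, State.emit_cnt]))
    (State.ext rfl rfl rfl (funext fun d => by grind [State.set_cnt, State.emit_cnt])) le_rfl

/-- Add the counter `a` to the counter `b`, and set it to zero. -/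
def moveTo (a b : Counter) : Prog Alphabet := .loop (.ctr a) fun _ => .push (.ctr b) ()

theorem runs_moveTo {a b : Counter} (hab : a ≠ b) (s : State) :
    Runs (moveTo a b) s ((s.set b (s.cnt b + s.cnt a)).set a 0) (s.cnt a * 2 + 1) := by
  have := Runs.loop (c := a) (b := fun _ => .push (.ctr b) ()) (m := s.cnt a) (t := 1)
    (fun j => (s.set b (s.cnt b + j)).set a (s.cnt a - j)) (by simp)
    (fun j _ => (Runs.push _ b).of_eq rfl
      (State.ext rfl rfl rfl (funext fun d => by grind [State.set_cnt, State.emit_cnt])) le_rfl)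
  exact this.of_eq (State.ext rfl rfl rfl (funext fun d => by grind [State.set_cnt, State.emit_cnt]))
    (State.ext rfl rfl rfl (funext fun d => by grind [State.set_cnt, State.emit_cnt])) le_rfl

/-- Add the counter `a` to the counter `b`. -/
def addTo (a b : Counter) : Prog Alphabet :=
  .seq (.loop (.ctr a) fun _ => .seq (.push (.ctr b) ()) (.push (.ctr aux) ())) (moveTo aux a)

/-- Reading a counter destroys it, so `a` is also copied to `aux` and restored from there. -/
theorem runs_addTo {a b : Counter} (hab : a ≠ b) (ha : a ≠ aux) (hb : b ≠ aux) (s : State)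
    (hs : s.cnt aux = 0) :
    Runs (addTo a b) s (s.set b (s.cnt b + s.cnt a)) (s.cnt a * 5 + 2) := by
  have := Runs.loop (c := a) (b := fun _ => .seq (.push (.ctr b) ()) (.push (.ctr aux) ()))
    (m := s.cnt a) (t := 2)
    (fun j => ((s.set b (s.cnt b + j)).set aux j).set a (s.cnt a - j)) (by simp)
    (fun j _ => ((Runs.push _ b).seq (Runs.push _ aux)).of_eq rfl
      (State.ext rfl rfl rfl (funext fun d => by grind [State.set_cnt, State.emit_cnt])) le_rfl)
  exact (Runs.seq this (runs_moveTo ha.symm _)).of_eq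
    (State.ext rfl rfl rfl (funext fun d => by grind [State.set_cnt, State.emit_cnt]))
    (State.ext rfl rfl rfl (funext fun d => by grind [State.set_cnt, State.emit_cnt])) (by grind [State.set_cnt, State.emit_cnt])

/-- Multiply the counter `y` by the counter `pos`. -/
def mulPos (y : Counter) : Prog Alphabet :=
  .seq (.loop (.ctr y) fun _ => addTo pos aux') (moveTo aux' y)

theorem runs_mulPos {y : Counter} (hy : y ≠ pos) (hy₁ : y ≠ aux) (hy₂ : y ≠ aux') (s : State)
    (hs : s.cnt aux = 0) (hs' : s.cnt aux' = 0) :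
    Runs (mulPos y) s (s.set y (s.cnt y * s.cnt pos))
      (s.cnt y * (s.cnt pos * 5 + 3) + 1 + (s.cnt y * s.cnt pos * 2 + 1)) := by
  have := Runs.loop (c := y) (b := fun _ => addTo pos aux') (m := s.cnt y) (t := s.cnt pos * 5 + 2)
    (fun j => (s.set aux' (j * s.cnt pos)).set y (s.cnt y - j)) (by simp)
    (fun j _ => (runs_addTo (a := pos) (b := aux') (by decide) (by decide) (by decide) _
        (by grind [State.set_cnt, State.emit_cnt])).of_eq rfl
      (State.ext rfl rfl rfl (funext fun d => by grind [State.set_cnt, State.emit_cnt])) (by grind [State.set_cnt, State.emit_cnt]))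
  exact (Runs.seq this (runs_moveTo hy₂.symm _)).of_eq
    (State.ext rfl rfl rfl (funext fun d => by grind [State.set_cnt, State.emit_cnt]))
    (State.ext rfl rfl rfl (funext fun d => by grind [State.set_cnt, State.emit_cnt])) (by grind [State.set_cnt, State.emit_cnt])

/-- The value at `n` of the polynomial with the coefficients `l`. -/
def horner (l : List ℕ) (n : ℕ) : ℕ := l.foldr (fun c r => r * n + c) 0

/-- Set the counter `y` to the value at the counter `pos` of the polynomial with the coefficients
`l`. -/
def evalPoly (y : Counter) : List ℕ → Prog Alphabet
  | [] => .skip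
  | c :: l => .seq (evalPoly y l) (.seq (mulPos y) (bump y c))

/-- A bound for the number of steps of `evalPoly`. -/
def evalPolyTime : List ℕ → ℕ → ℕ
  | [], _ => 1
  | c :: l, n => evalPolyTime l n +
    ((horner l n * (n * 5 + 3) + 1 + (horner l n * n * 2 + 1)) + (c + 1))

theorem runs_evalPoly {y : Counter} (hy : y ≠ pos) (hy₁ : y ≠ aux) (hy₂ : y ≠ aux') (l : List ℕ)
    (s : State) (hs : s.cnt aux = 0) (hs' : s.cnt aux' = 0) (hs₀ : s.cnt y = 0) :
    Runs (evalPoly y l) s (s.set y (horner l (s.cnt pos))) (evalPolyTime l (s.cnt pos)) := by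
  induction l with
  | nil =>
    exact (Runs.skip s).of_eq rfl
      (State.ext rfl rfl rfl (funext fun d => by simp [horner]; grind)) le_rfl
  | cons c l ih =>
    have h₁ := runs_mulPos hy hy₁ hy₂ (s.set y (horner l (s.cnt pos))) (by grind [State.set_cnt, State.emit_cnt])
      (by grind [State.set_cnt, State.emit_cnt])
    refine (ih.seq (h₁.seq (runs_bump y c _))).of_eq rfl
      (State.ext rfl rfl rfl (funext fun d => ?_)) ?_
    · have : horner (c :: l) (s.cnt pos) = horner l (s.cnt pos) * s.cnt pos + c := rfl
      simp [this, hy.symm]; grind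
    · simp [evalPolyTime, hy.symm]

/-! ### Writing the formula -/

/-- A part of a text that depends on two counters. -/
inductive TextPart
  | sym (a : FormulaSymbol) | row | column

/-- The text for the values `t` and `i` of the counters. -/
def text (w : List TextPart) (t i : ℕ) : List FormulaSymbol :=
  w.flatMap fun
    | .sym a => [a]
    | .row => List.replicate t (.bit true)
    | .column => List.replicate i (.bit true)

/-- Write the counter `k` in unary. -/
def writeCounter (k : Counter) : Prog Alphabet :=
  .seq (.loop (.ctr k) fun _ => .seq (.push .tmp (FormulaSymbol.bit true)) (.push (.ctr aux) ()))
    (moveTo aux k)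

theorem runs_writeCounter {k : Counter} (hk : k ≠ aux) (s : State) (hs : s.cnt aux = 0) :
    Runs (writeCounter k) s (s.emit (List.replicate (s.cnt k) (.bit true))) (s.cnt k * 5 + 2) := by
  have := Runs.loop (c := k)
    (b := fun _ => .seq (.push .tmp (FormulaSymbol.bit true)) (.push (.ctr aux) ()))
    (m := s.cnt k) (t := 2)
    (fun j => ((s.emit (List.replicate j (.bit true))).set aux j).set k (s.cnt k - j)) (by simp)
    (fun j _ => ((Runs.emit _ (.bit true)).seq (Runs.push _ aux)).of_eq rfl
      (State.ext rfl (by simp [List.replicate_succ']) rfl (funext fun d => by simp; grind))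
      le_rfl)
  exact (Runs.seq this (runs_moveTo hk.symm _)).of_eq
    (State.ext rfl rfl rfl (funext fun d => by grind [State.set_cnt, State.emit_cnt]))
    (State.ext rfl rfl rfl (funext fun d => by grind [State.set_cnt, State.emit_cnt])) (by grind [State.set_cnt, State.emit_cnt])

/-- Write a text with the counters `kt` and `ki`. -/
def writeText (kt ki : Counter) : List TextPart → Prog Alphabet
  | [] => .skip
  | .sym a :: w => .seq (.push .tmp a) (writeText kt ki w)
  | .row :: w => .seq (writeCounter kt) (writeText kt ki w)
  | .column :: w => .seq (writeCounter ki) (writeText kt ki w)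

theorem runs_writeText {kt ki : Counter} (ht : kt ≠ aux) (hi : ki ≠ aux) (w : List TextPart)
    (s : State) (hs : s.cnt aux = 0) :
    Runs (writeText kt ki w) s (s.emit (text w (s.cnt kt) (s.cnt ki)))
      (w.length * ((s.cnt kt + s.cnt ki) * 5 + 2) + 1) := by
  induction w generalizing s with
  | nil => exact (Runs.skip s).mono (by omega)
  | cons a w ih =>
    have aux : ∀ (p : Prog Alphabet) (v : List FormulaSymbol),
        Runs p s (s.emit v) ((s.cnt kt + s.cnt ki) * 5 + 2) →
        Runs (.seq p (writeText kt ki w)) s (s.emit (v ++ text w (s.cnt kt) (s.cnt ki)))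
          ((w.length + 1) * ((s.cnt kt + s.cnt ki) * 5 + 2) + 1) := by
      intro p v h
      have := (h.seq (ih (s.emit v) hs)).mono
        (t' := (w.length + 1) * ((s.cnt kt + s.cnt ki) * 5 + 2) + 1) (by simp; grind)
      rwa [State.emit_emit] at this
    cases a with
    | sym a => exact aux _ _ ((Runs.emit s a).mono (by omega))
    | row => exact aux _ _ ((runs_writeCounter ht s hs).mono (by omega))
    | column => exact aux _ _ ((runs_writeCounter hi s hs).mono (by omega))

/-- The text of a literal. -/
def literalText (l : TemplateLiteral) : List TextPart :=
  .sym (.literal l.sign) :: (List.replicate l.code (.sym (.bit true)) ++ .sym (.bit false) :: .row ::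
    (List.replicate l.dt (.sym (.bit true)) ++ .sym (.bit false) :: .column ::
      List.replicate (l.di + 1) (.sym (.bit true))))

theorem text_append (w w' : List TextPart) (t i : ℕ) :
    text (w ++ w') t i = text w t i ++ text w' t i := List.flatMap_append

theorem text_cons (a : TextPart) (w : List TextPart) (t i : ℕ) :
    text (a :: w) t i = text [a] t i ++ text w t i := by
  rw [← text_append]; rfl

theorem text_replicate (a : FormulaSymbol) (n t i : ℕ) :
    text (List.replicate n (.sym a)) t i = List.replicate n a := by
  induction n with
  | zero => rfl
  | succ n ih => rw [List.replicate_succ, text_cons, ih]; rfl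

theorem text_flatMap {α : Type*} (L : List α) (g : α → List TextPart) (t i : ℕ) :
    text (L.flatMap g) t i = L.flatMap fun a => text (g a) t i := by
  unfold text
  rw [List.flatMap_assoc]

/-- The code and the offsets are constants of the template. Since names are unary in the
coordinates, shifting to `(t, i)` only inserts copies of the two counters. -/
theorem text_literalText (l : TemplateLiteral) (t i : ℕ) :
    text (literalText l) t i = (l.inst t i).encode := by
  have h : ∀ (a : FormulaSymbol), text [.sym a] t i = [a] := fun _ => rfl
  have hr : text [.row] t i = List.replicate t (.bit true) := by simp [text]
  have hc : text [.column] t i = List.replicate i (.bit true) := by simp [text]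
  simp only [literalText, Literal.encode, TemplateLiteral.inst, encodeNat_varNum, varBits]
  rw [text_cons, text_append, text_cons (.sym (.bit false)) (.row :: _), text_cons .row,
    text_append, text_cons (.sym (.bit false)) (.column :: _), text_cons .column]
  simp only [text_replicate, h, hr, hc, List.map_append, List.map_cons, List.map_replicate,
    List.replicate_add, add_assoc, List.append_assoc, List.cons_append, List.nil_append,
    text_append]

/-- The text of a family of clauses. -/
def familyText (templ : ℕ → List (List TemplateLiteral)) (f : ℕ) : List TextPart :=
  (expand templ f).flatMap fun c => .sym .clause :: c.flatMap literalText

theorem text_familyText (templ : ℕ → List (List TemplateLiteral)) (f t i : ℕ) :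
    text (familyText templ f) t i = (block templ (f, t, i)).encode := by
  rw [familyText, text_flatMap, Formula.encode, block, List.flatMap_map]
  congr 1
  ext1 c
  rw [text_cons, text_flatMap, Clause.encode, List.flatMap_map]
  simp only [text_literalText]
  rfl

theorem encode_formulaOf (templ : ℕ → List (List TemplateLiteral)) (I : List (ℕ × ℕ × ℕ)) :
    (formulaOf templ I).encode = I.flatMap fun p => text (familyText templ p.1) p.2.1 p.2.2 := by
  simp only [text_familyText, Formula.encode, formulaOf, List.flatMap_assoc]

end SatVariant

/-! ### The program that prints the formula, and its running time. -/

namespace SatVariant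

open Counter

/-! ### The program for the reduction -/

/-- Write the clauses for the input. -/
def writeInput (w : ℕ → List TextPart) : Prog Alphabet :=
  .loop .inp fun b => .seq (writeText row pos (w (Bool.toNat b))) (.push (.ctr pos) ())

/-- Write the clauses for the places of the certificate. -/
def writeCerts (w : List TextPart) : Prog Alphabet :=
  .loop (.ctr certs) fun _ => .seq (writeText row pos w) (.push (.ctr pos) ())

/-- Write the clauses for a row. -/
def writeRow (w : List TextPart) : Prog Alphabet :=
  .seq (.loop (.ctr columns) fun _ => .seq (writeText row column w) (.push (.ctr column) ()))
    (moveTo column columns)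

/-- Write the clauses for all rows. -/
def writeSquare (w : List TextPart) : Prog Alphabet :=
  .loop (.ctr rows) fun _ => .seq (writeRow w) (.push (.ctr row) ())

/-- Write the formula in reverse on the temporary stack, for the polynomials with the coefficients
`lp` and `lt`. -/
def writeFormula (w : ℕ → List TextPart) (lp lt : List ℕ) : Prog Alphabet :=
  .seq (writeInput w) <| .seq (evalPoly certs lp) <| .seq (evalPoly rows lt) <|
  .seq (evalPoly columns lt) <| .seq (writeCerts (w 2)) <| .seq (writeText row pos (w 3)) <|
  .seq (clear pos) <| .seq (writeText row pos (w 4)) <| .seq (writeSquare (w 5)) <|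
  .seq (clear row) (clear columns)

/-- The program for the reduction. -/
def reduction (w : ℕ → List TextPart) (lp lt : List ℕ) : Prog Alphabet :=
  .seq (writeFormula w lp lt) (.loop .tmp fun a => .push .out a)

/-- The state where all stacks but those for the input and the output are empty. -/
def ioState (x : List Bool) (out : List FormulaSymbol) : State := ⟨x, [], out, fun _ => 0⟩

/-- A bound for the number of steps for writing a text of length at most `L` for counters with the
sum at most `m`. -/
def textTime (L m : ℕ) : ℕ := L * (m * 5 + 2) + 1

theorem runs_writeText' {kt ki : Counter} (ht : kt ≠ aux) (hi : ki ≠ aux) {w : List TextPart}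
    {s : State} (hs : s.cnt aux = 0) {L m t i : ℕ} (hL : w.length ≤ L) (hkt : s.cnt kt = t)
    (hki : s.cnt ki = i) (hm : t + i ≤ m) :
    Runs (writeText kt ki w) s (s.emit (text w t i)) (textTime L m) := by
  subst hkt hki
  refine (runs_writeText ht hi w s hs).mono ?_
  unfold textTime
  gcongr

theorem runs_writeInput {w : ℕ → List TextPart} {L : ℕ} (hL : ∀ f ≤ 5, (w f).length ≤ L)
    (x : List Bool) :
    Runs (writeInput w) (ioState x [])
      (((ioState [] []).emit (x.zipIdx.flatMap fun p => text (w p.1.toNat) 0 p.2)).set pos x.length)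
      (x.length * (textTime L x.length + 1 + 1) + 1) := by
  have := Runs.loop_inp
    (b := fun b => .seq (writeText row pos (w (Bool.toNat b))) (.push (.ctr pos) ()))
    (x := x) (t := textTime L x.length + 1)
    (fun j => ((ioState (x.drop j) []).emit
      ((x.take j).zipIdx.flatMap fun p => text (w p.1.toNat) 0 p.2)).set pos j)
    (fun j => rfl) (fun j h => by
      refine ((runs_writeText' (t := 0) (i := j) (by decide) (by decide) ?_
        (hL _ ((Bool.toNat_le _).trans (by decide))) ?_ ?_ (by omega)).seq
        (Runs.push _ pos)).of_eq rfl (State.ext rfl ?_ rfl (funext fun d => ?_)) le_rfl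
      · rfl
      · rfl
      · simp
      · rw [List.take_succ_eq_append_getElem h, List.zipIdx_append, List.flatMap_append]
        simp [h.le, ioState]
      · simp [ioState]; grind)
  refine this.of_eq (State.ext ?_ ?_ rfl (funext fun d => ?_)) (State.ext ?_ ?_ rfl rfl) le_rfl
  · simp [ioState]
  · simp [ioState]
  · simp [ioState]
  · simp [ioState]
  · simp

theorem runs_writeCerts {w : List TextPart} {L n P : ℕ} (hL : w.length ≤ L) (s : State)
    (h₁ : s.cnt aux = 0) (h₂ : s.cnt row = 0) (h₃ : s.cnt pos = n) (h₄ : s.cnt certs = P) :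
    Runs (writeCerts w) s
      (((s.emit ((List.range P).flatMap fun j => text w 0 (n + j))).set pos (n + P)).set certs 0)
      (P * (textTime L (n + P) + 1 + 1) + 1) := by
  have := Runs.loop (c := certs) (b := fun _ => .seq (writeText row pos w) (.push (.ctr pos) ()))
    (m := P) (t := textTime L (n + P) + 1)
    (fun j => ((s.emit ((List.range j).flatMap fun j => text w 0 (n + j))).set pos (n + j)).set
      certs (P - j)) (by simp) (fun j h => by
      refine ((runs_writeText' (t := 0) (i := n + j) (by decide) (by decide) ?_ hL ?_ ?_
        (by omega)).seq (Runs.push _ pos)).of_eq rfl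
        (State.ext rfl ?_ rfl (funext fun d => ?_)) le_rfl
      · simpa using h₁
      · simpa using h₂
      · simp
      · simp [List.range_succ]
      · simp; grind)
  refine this.of_eq (State.ext rfl rfl rfl (funext fun d => ?_))
    (State.ext rfl rfl rfl (funext fun d => ?_)) le_rfl
  · simp; grind
  · simp

theorem runs_writeRow {w : List TextPart} {L T t : ℕ} (hL : w.length ≤ L) (ht : t ≤ T) (s : State)
    (h₁ : s.cnt aux = 0) (h₂ : s.cnt row = t) (h₃ : s.cnt column = 0) (h₄ : s.cnt columns = T) :
    Runs (writeRow w) s (s.emit ((List.range T).flatMap fun i => text w t i))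
      (T * (textTime L (T + T) + 1 + 1) + 1 + (T * 2 + 1)) := by
  have := Runs.loop (c := columns)
    (b := fun _ => .seq (writeText row column w) (.push (.ctr column) ()))
    (m := T) (t := textTime L (T + T) + 1)
    (fun j => ((s.emit ((List.range j).flatMap fun i => text w t i)).set column j).set
      columns (T - j)) (by simp) (fun j h => by
      refine ((runs_writeText' (t := t) (i := j) (by decide) (by decide) ?_ hL ?_ ?_
        (by omega)).seq (Runs.push _ column)).of_eq rfl
        (State.ext rfl ?_ rfl (funext fun d => ?_)) le_rfl
      · simpa using h₁
      · simpa using h₂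
      · simp
      · simp [List.range_succ]
      · simp; grind)
  refine (this.seq (runs_moveTo (a := column) (b := columns) (by decide) _)).of_eq
    (State.ext rfl rfl rfl (funext fun d => ?_)) (State.ext rfl rfl rfl (funext fun d => ?_)) ?_
  · simp; grind
  · simp; grind
  · simp

theorem runs_writeSquare {w : List TextPart} {L T : ℕ} (hL : w.length ≤ L) (s : State)
    (h₁ : s.cnt aux = 0) (h₂ : s.cnt row = 0) (h₃ : s.cnt column = 0) (h₄ : s.cnt columns = T)
    (h₅ : s.cnt rows = T) :
    Runs (writeSquare w) s
      (((s.emit ((List.range T).flatMap fun t => (List.range T).flatMap fun i => text w t i)).set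
        row T).set rows 0)
      (T * (T * (textTime L (T + T) + 1 + 1) + 1 + (T * 2 + 1) + 1 + 1) + 1) := by
  have := Runs.loop (c := rows) (b := fun _ => .seq (writeRow w) (.push (.ctr row) ()))
    (m := T) (t := T * (textTime L (T + T) + 1 + 1) + 1 + (T * 2 + 1) + 1)
    (fun j => ((s.emit ((List.range j).flatMap fun t =>
      (List.range T).flatMap fun i => text w t i)).set row j).set rows (T - j)) (by simp)
    (fun j h => by
      refine ((runs_writeRow hL (t := j) h.le _ ?_ ?_ ?_ ?_).seq (Runs.push _ row)).of_eq rfl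
        (State.ext rfl ?_ rfl (funext fun d => ?_)) le_rfl
      · simpa using h₁
      · simp
      · simpa using h₃
      · simpa using h₄
      · simp [List.range_succ]
      · simp; grind)
  refine this.of_eq (State.ext rfl rfl rfl (funext fun d => ?_))
    (State.ext rfl rfl rfl (funext fun d => ?_)) le_rfl
  · simp; grind
  · simp

/-- The text of the formula. -/
def formulaText (w : ℕ → List TextPart) (x : List Bool) (P T : ℕ) : List FormulaSymbol :=
  (TilingSystem.instances x P T).flatMap fun p => text (w p.1) p.2.1 p.2.2

theorem formulaText_eq (w : ℕ → List TextPart) (x : List Bool) (P T : ℕ) :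
    formulaText w x P T =
      (x.zipIdx.flatMap fun p => text (w p.1.toNat) 0 p.2) ++
      (((List.range P).flatMap fun j => text (w 2) 0 (x.length + j)) ++
        (text (w 3) 0 (x.length + P) ++ (text (w 4) 0 0 ++
          ((List.range T).flatMap fun t => (List.range T).flatMap fun i => text (w 5) t i)))) := by
  simp only [formulaText, TilingSystem.instances, List.flatMap_append, List.flatMap_map,
    List.flatMap_cons, List.flatMap_nil, List.append_nil, List.append_assoc, List.flatMap_assoc]

/-- A bound for the number of steps of `writeFormula`. -/
def writeFormulaTime (L : ℕ) (lp lt : List ℕ) (n : ℕ) : ℕ :=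
  n * (textTime L n + 1 + 1) + 1 + (evalPolyTime lp n + (evalPolyTime lt n + (evalPolyTime lt n +
    (horner lp n * (textTime L (n + horner lp n) + 1 + 1) + 1 + (textTime L (n + horner lp n) +
    ((n + horner lp n) * 2 + 1 + (textTime L 0 +
    (horner lt n * (horner lt n * (textTime L (horner lt n + horner lt n) + 1 + 1) + 1 +
      (horner lt n * 2 + 1) + 1 + 1) + 1 +
    (horner lt n * 2 + 1 + (horner lt n * 2 + 1))))))))))

/-- After the input is read, `pos` is its length, the argument of both polynomials; it then keeps
counting the places of row `0`. All counters end at zero, as a halting machine must leave only its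
output. -/
theorem runs_writeFormula {w : ℕ → List TextPart} {L : ℕ} (hL : ∀ f ≤ 5, (w f).length ≤ L)
    (lp lt : List ℕ) (x : List Bool) :
    Runs (writeFormula w lp lt) (ioState x [])
      ((ioState [] []).emit (formulaText w x (horner lp x.length) (horner lt x.length)))
      (writeFormulaTime L lp lt x.length) := by
  have h := runs_writeInput hL x
  generalize hs : ((ioState [] []).emit _).set pos x.length = s at h
  generalize hA : (x.zipIdx.flatMap fun p => text (w p.1.toNat) 0 p.2) = A at hs
  rw [formulaText_eq, hA]
  have hc : ∀ c, s.cnt c = if c = pos then x.length else 0 := by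
    subst hs; intro c; simp [ioState]
  have hpos : s.cnt pos = x.length := by simp [hc]
  generalize hP : horner lp x.length = P
  generalize hT : horner lt x.length = T
  have h₁ := runs_evalPoly (y := certs) (by decide) (by decide) (by decide) lp s
    (by simp [hc]) (by simp [hc]) (by simp [hc])
  rw [hpos, hP] at h₁
  have h₂ := runs_evalPoly (y := rows) (by decide) (by decide) (by decide) lt (s.set certs P)
    (by simp [hc]) (by simp [hc]) (by simp [hc])
  have h₃ := runs_evalPoly (y := columns) (by decide) (by decide) (by decide) lt
    ((s.set certs P).set rows T) (by simp [hc]) (by simp [hc]) (by simp [hc])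
  have e₂ : (s.set certs P).cnt pos = x.length := by simp [hc]
  have e₃ : ((s.set certs P).set rows T).cnt pos = x.length := by simp [hc]
  rw [e₂, hT] at h₂
  rw [e₃, hT] at h₃
  have h₄ := runs_writeCerts (n := x.length) (P := P) (hL 2 (by decide))
    (((s.set certs P).set rows T).set columns T)
    (by simp [hc]) (by simp [hc]) (by simp [hc]) (by simp)
  generalize hs₄ : (((((s.set certs P).set rows T).set columns T).emit _).set pos _).set certs 0
    = s₄ at h₄
  have hc₄ : ∀ c, s₄.cnt c =
      if c = pos then x.length + P else if c = rows ∨ c = columns then T else 0 := by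
    subst hs₄; intro c; cases c <;> simp [hc]
  have h₅ := runs_writeText' (kt := row) (ki := pos) (by decide) (by decide) (s := s₄)
    (t := 0) (i := x.length + P) (by simp [hc₄]) (hL 3 (by decide)) (by simp [hc₄])
    (by simp [hc₄]) (m := x.length + P) (by simp)
  have h₆ := runs_clear pos (s₄.emit (text (w 3) 0 (x.length + P)))
  have h₇ := runs_writeText' (kt := row) (ki := pos) (by decide) (by decide)
    (s := (s₄.emit (text (w 3) 0 (x.length + P))).set pos 0)
    (t := 0) (i := 0) (by simp [hc₄]) (hL 4 (by decide)) (by simp [hc₄])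
    (by simp) (m := 0) (by simp)
  have h₈ := runs_writeSquare (T := T) (hL 5 (by decide))
    (((s₄.emit (text (w 3) 0 (x.length + P))).set pos 0).emit (text (w 4) 0 0))
    (by simp [hc₄]) (by simp [hc₄]) (by simp [hc₄]) (by simp [hc₄]) (by simp [hc₄])
  have h₉ := fun s => (runs_clear row s).seq (runs_clear columns _)
  refine (h.seq <| h₁.seq <| h₂.seq <| h₃.seq <| h₄.seq <| h₅.seq <| h₆.seq <| h₇.seq <|
    h₈.seq (h₉ _)).of_eq rfl (State.ext ?_ ?_ ?_ (funext fun d => ?_)) ?_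
  · subst hs₄ hs; rfl
  · subst hs₄ hs; simp [ioState]
  · subst hs₄ hs; rfl
  · cases d <;> simp [hc₄, ioState]
  · simp [writeFormulaTime, hc₄, hP, hT]

theorem run_reduction {w : ℕ → List TextPart} {L : ℕ} (hL : ∀ f ≤ 5, (w f).length ≤ L)
    (lp lt : List ℕ) (x : List Bool) :
    Runs (reduction w lp lt) (ioState x [])
      (ioState [] (formulaText w x (horner lp x.length) (horner lt x.length)))
      (writeFormulaTime L lp lt x.length * 3 + 1) := by
  have h := runs_writeFormula hL lp lt x
  refine (h.seq (Runs.reverse _)).of_eq rfl (State.ext rfl rfl ?_ rfl) ?_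
  · simp [ioState]
  -- Reversal takes two steps per symbol, and the text is no longer than the time spent on writing
  -- it; this explains the factor 3.
  · obtain ⟨n, hn, h⟩ := h
    have hlen : ((ioState [] []).emit
        (formulaText w x (horner lp x.length) (horner lt x.length))).tmp.length ≤ 0 + n :=
      h.length_le .tmp
    omega

/-! ### Polynomial bounds -/

/-- The function `f` is bounded by a polynomial. -/
def PolyBounded (f : ℕ → ℕ) : Prop := ∃ p : Polynomial ℕ, ∀ n, f n ≤ p.eval n

namespace PolyBounded

theorem const (c : ℕ) : PolyBounded fun _ => c := ⟨.C c, by simp⟩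

theorem id : PolyBounded fun n => n := ⟨.X, by simp⟩

theorem add {f g : ℕ → ℕ} (hf : PolyBounded f) (hg : PolyBounded g) :
    PolyBounded fun n => f n + g n :=
  let ⟨p, hp⟩ := hf
  let ⟨q, hq⟩ := hg
  ⟨p + q, fun n => by rw [Polynomial.eval_add]; exact Nat.add_le_add (hp n) (hq n)⟩

theorem mul {f g : ℕ → ℕ} (hf : PolyBounded f) (hg : PolyBounded g) :
    PolyBounded fun n => f n * g n :=
  let ⟨p, hp⟩ := hf
  let ⟨q, hq⟩ := hg
  ⟨p * q, fun n => by rw [Polynomial.eval_mul]; exact Nat.mul_le_mul (hp n) (hq n)⟩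

theorem horner (l : List ℕ) : PolyBounded (horner l) := by
  induction l with
  | nil => exact const 0
  | cons c l ih => exact (ih.mul id).add (const c)

theorem evalPolyTime (l : List ℕ) : PolyBounded (evalPolyTime l) := by
  induction l with
  | nil => exact const 1
  | cons c l ih =>
    have h := PolyBounded.horner l
    exact ih.add (((((h.mul ((id.mul (const 5)).add (const 3))).add (const 1)).add
      (((h.mul id).mul (const 2)).add (const 1))).add (const (c + 1))))

theorem textTime (L : ℕ) {f : ℕ → ℕ} (hf : PolyBounded f) :
    PolyBounded fun n => textTime L (f n) :=
  ((const L).mul ((hf.mul (const 5)).add (const 2))).add (const 1)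

theorem writeFormulaTime (L : ℕ) (lp lt : List ℕ) : PolyBounded (writeFormulaTime L lp lt) := by
  have hp := horner lp
  have ht := horner lt
  have c1 := const 1
  have c2 := const 2
  exact ((id.mul (((textTime L id).add c1).add c1)).add c1).add <| (evalPolyTime lp).add <|
    (evalPolyTime lt).add <| (evalPolyTime lt).add <|
    ((hp.mul (((textTime L (id.add hp)).add c1).add c1)).add c1).add <|
    (textTime L (id.add hp)).add <| (((id.add hp).mul c2).add c1).add <|
    (textTime L (const 0)).add <|
    ((ht.mul (((((ht.mul (((textTime L (ht.add ht)).add c1).add c1)).add c1).add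
      ((ht.mul c2).add c1)).add c1).add c1)).add c1).add <|
    ((ht.mul c2).add c1).add ((ht.mul c2).add c1)

end PolyBounded

theorem exists_horner (p : Polynomial ℕ) : ∃ l, ∀ n, horner l n = p.eval n := by
  induction p using Polynomial.recOnHorner with
  | M0 => exact ⟨[], fun n => by simp [horner]⟩
  | MC p a _ _ ih =>
    obtain ⟨l, h⟩ := ih
    cases l with
    | nil => exact ⟨[a], fun n => by rw [Polynomial.eval_add, ← h]; simp [horner]⟩
    | cons c l =>
      refine ⟨(c + a) :: l, fun n => ?_⟩
      rw [Polynomial.eval_add, ← h]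
      simp [horner, add_assoc]
  | MX p _ ih =>
    obtain ⟨l, h⟩ := ih
    exact ⟨0 :: l, fun n => by rw [Polynomial.eval_mul, ← h]; simp [horner]⟩

/-- The reduction is computable in polynomial time. -/
theorem polyTimeComputable_formula {D : Type} [Fintype D] (W : TilingSystem D)
    (p q : Polynomial ℕ) :
    PolyTimeComputable bitStrings formulaEncoding
      fun x => W.formula x (p.eval x.length) (q.eval x.length) := by
  obtain ⟨lp, hp⟩ := exists_horner p
  obtain ⟨lt, ht⟩ := exists_horner q
  let w := familyText W.templ
  -- A common bound for the six texts; it depends on the tiling system only, not on the input.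
  let L := ∑ f ∈ Finset.range 6, (w f).length
  have hL : ∀ f ≤ 5, (w f).length ≤ L := fun f hf =>
    Finset.single_le_sum (f := fun f => (w f).length) (fun _ _ => Nat.zero_le _)
      (Finset.mem_range.2 (by omega))
  obtain ⟨r, hr⟩ := ((PolyBounded.writeFormulaTime L lp lt).mul (.const 3)).add (.const 1)
  refine Prog.polyTimeComputable (reduction w lp lt) .inp .out (Equiv.refl Bool)
    (Equiv.refl FormulaSymbol) r fun x => ?_
  obtain ⟨n, hn, h⟩ := run_reduction hL lp lt x
  refine ⟨n, hn.trans (hr _), ?_⟩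
  convert h using 1
  · ext1 k
    cases k with
    | inp => exact (Function.update_self ..).trans (List.map_id _)
    | _ => rfl
  · ext1 k
    cases k with
    | out =>
      refine (Function.update_self ..).trans ((List.map_id _).trans ?_)
      change Formula.encode (W.formula x (p.eval x.length) (q.eval x.length)) = _
      rw [← hp, ← ht]
      exact encode_formulaOf _ _
    | _ => rfl

end SatVariant

/-! ### From a verifier to the reduction. -/

namespace SatVariant

open Turing

/-! ### The reduction from a verifier -/

theorem monotone_eval (p : Polynomial ℕ) : Monotone fun n => p.eval n := by
  intro a b hab
  simp only [Polynomial.eval_eq_sum_range]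
  gcongr

attribute [local instance] FinTM2.kFin FinTM2.ΛFin FinTM2.σFin

/-- Machines that compute the function `V` of two bit strings in polynomial time. -/
abbrev Verifier (V : List Bool × List Bool → Bool) : Type 1 :=
  TM2ComputableInPolyTime (Computability.encodingProd bitStrings bitStrings).encode
    Computability.encodingBoolBool.encode V

namespace Verifier

variable {V : List Bool × List Bool → Bool} (M : Verifier V)

/-- The top of the stacks shows that the verifier accepts. -/
def Accepts (c : Micro.Column M.tm.Γ) : Prop := c M.tm.k₁ = some (M.outputAlphabet.symm true)

/-- The small-step configuration for the input `x` and the certificate `y`. -/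
def init (x y : List Bool) : Micro.Control M.tm.Γ M.tm.Λ M.tm.σ × Micro.Stacks M.tm.Γ :=
  ((some (M.tm.m M.tm.main), M.tm.initialState), Micro.initStacks M.inputAlphabet.symm x y)

/-- The tiling system for the verifier. -/
noncomputable def tiling : TilingSystem (Micro.Tile M.tm.m) :=
  Micro.tiling M.tm.m M.Accepts M.tm.main M.tm.initialState M.inputAlphabet.symm

/-- The encoded pair is `x` followed by `y` with different tags, exactly what row 0 of the tiling
admits, and its length is `x.length + y.length`. -/
theorem exists_halts : ∃ C, ∀ x y, ∃ j ≤ C * M.time.eval (x.length + y.length),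
    iter (Micro.mstep M.tm.m M.Accepts) j (M.init x y) =
      some ((none, M.tm.initialState),
        Function.update (fun _ => []) M.tm.k₁ [M.outputAlphabet.symm (V (x, y))]) := by
  obtain ⟨C, hC⟩ := Micro.exists_iter_mstep M.tm.m M.Accepts
  refine ⟨C, fun x y => ?_⟩
  obtain ⟨⟨n, hn⟩, hn'⟩ := M.outputsFun (x, y)
  rw [Prog.initList_eq, Option.map_some, Prog.haltList_eq] at hn
  obtain ⟨j, hj, h⟩ := hC n _ _ hn
  refine ⟨j, hj.trans (Nat.mul_le_mul_left _ (hn'.trans (le_of_eq ?_))), ?_⟩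
  · simp [Computability.encodingProd, bitStrings, Computability.encodingList]
  · have e : (Computability.encodingProd bitStrings bitStrings).encode (x, y) =
        x.map Sum.inl ++ y.map Sum.inr := by
      simp [Computability.encodingProd, bitStrings, Computability.encodingList]
    rw [e] at h
    exact h

/-- The accepting final configuration is a fixed point of the small step. -/
theorem iter_ne_none_of_accepts {x y : List Bool} (h : V (x, y) = true) (t : ℕ) :
    iter (Micro.mstep M.tm.m M.Accepts) t (M.init x y) ≠ none := by
  obtain ⟨C, hC⟩ := M.exists_halts
  obtain ⟨j, -, hj⟩ := hC x y
  rw [h] at hj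
  have hstay : ∀ m, iter (Micro.mstep M.tm.m M.Accepts) (j + m) (M.init x y) =
      some ((none, M.tm.initialState),
        Function.update (fun _ => []) M.tm.k₁ [M.outputAlphabet.symm true]) := by
    intro m
    induction m with
    | zero => exact hj
    | succ m ih =>
      rw [← add_assoc, iter_succ, ih, Option.bind_some, Micro.mstep, Micro.ctrl, if_pos]
      · rfl
      · simp [Accepts, Micro.col]
  exact iter_ne_none_of_le (n := j + t) (by rw [hstay]; simp) (by omega)

theorem iter_eq_none_of_rejects {x y : List Bool} (h : V (x, y) = false) {j : ℕ}
    (hj : iter (Micro.mstep M.tm.m M.Accepts) j (M.init x y) =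
      some ((none, M.tm.initialState),
        Function.update (fun _ => []) M.tm.k₁ [M.outputAlphabet.symm (V (x, y))])) :
    iter (Micro.mstep M.tm.m M.Accepts) (j + 1) (M.init x y) = none := by
  rw [iter_succ, hj, Option.bind_some, Micro.mstep, Micro.ctrl, if_neg]
  · rfl
  · simp [Accepts, Micro.col, h]

end Verifier

/-- Polynomial-time verification reduces to satisfiability of formulas with the three conditions. -/
theorem exists_reduction {V : List Bool × List Bool → Bool} (M : Verifier V)
    (hM : ∀ k, Finite (M.tm.Γ k)) (p : Polynomial ℕ) :
    ∃ f : List Bool → Formula, PolyTimeComputable bitStrings formulaEncoding f ∧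
      ∀ x, ((f x).ThreeLiterals ∧ (f x).NoOppositeLiterals ∧ (f x).PairsAtMostOnce) ∧
        ((∃ y : List Bool, y.length ≤ p.eval x.length ∧ V (x, y) = true) ↔ (f x).Satisfiable) := by
  have := Micro.finite_tile M.tm.m
  let _ : Fintype (Micro.Tile M.tm.m) := Fintype.ofFinite _
  have : Nonempty (Micro.Tile M.tm.m) :=
    ⟨⟨none, fun _ => none, fun _ => none, ⟨none, by simp [TM2.stmts]⟩, M.tm.initialState⟩⟩
  obtain ⟨C, hC⟩ := M.exists_halts
  -- The side of the square must exceed `x.length + P`, so that row 0 fits, and also `j + 1`, where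
  -- `j` is the number of small steps until halting on a certificate of length at most `P`; the next
  -- step exposes a rejection.
  let q : Polynomial ℕ := .C C * M.time.comp (.X + p) + .X + p + 2
  have hq : ∀ n, q.eval n = C * M.time.eval (n + p.eval n) + n + p.eval n + 2 := by simp [q]
  refine ⟨_, polyTimeComputable_formula M.tiling p q, fun x => ⟨⟨?_, ?_, ?_⟩, ?_, ?_⟩⟩
  · exact threeLiterals_formulaOf _ M.tiling.even_templ
  · exact noOppositeLiterals_formulaOf _ M.tiling.even_templ
  · exact pairsAtMostOnce_formulaOf (TilingSystem.nodup_instances _ _ _) M.tiling.even_templ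
  · rintro ⟨y, hy, hV⟩
    obtain ⟨τ, h₀, hh, hv⟩ := Micro.exists_tiling_of_run hy (M.iter_ne_none_of_accepts hV)
    exact M.tiling.satisfiable_of_tiling h₀ hh hv
  · intro h
    obtain ⟨τ, h₀, hh, hv⟩ := M.tiling.exists_tiling (by rw [hq]; omega) h
    obtain ⟨y, hy, hrun⟩ := Micro.exists_run (by rw [hq]; omega) h₀ hh hv
    refine ⟨y, hy, ?_⟩
    by_contra hV
    obtain ⟨j, hj, hj'⟩ := hC x y
    have hmono : M.time.eval (x.length + y.length) ≤ M.time.eval (x.length + p.eval x.length) :=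
      monotone_eval M.time (Nat.add_le_add_left hy _)
    have := Nat.mul_le_mul_left C hmono
    -- A rejecting run would be stuck at step `j + 1`, still inside the square.
    exact hrun (j + 1) (by rw [hq]; omega)
      (M.iter_eq_none_of_rejects (Bool.not_eq_true _ ▸ hV) hj')

end SatVariant

theorem lemmal :
    SatVariant.NPHard SatVariant.formulaEncoding
      {Φ : SatVariant.Formula | SatVariant.Formula.ThreeLiterals Φ ∧
        SatVariant.Formula.NoOppositeLiterals Φ ∧ SatVariant.Formula.PairsAtMostOnce Φ}
      {Φ : SatVariant.Formula | SatVariant.Formula.Satisfiable Φ} := by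
  rintro L ⟨p, V, ⟨M, hM⟩, hL⟩
  obtain ⟨f, hf, h⟩ := SatVariant.exists_reduction M hM p
  exact ⟨f, hf, fun x => ⟨(h x).1, (hL x).trans (h x).2⟩⟩
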